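/- Let $n\ge 3$ be an odd integer, let $m=\operatorname{ord}_n(2)$ be the multiplicative order of $2$ modulo $n$, and suppose that $2^{\lfloor m/2\rfloor}<n\le 2^m-1$. Put $\kappa=\frac{n}{2^m-1}\left(2^{\lceil m/2\rceil}-1\right)$. Let $a,b,e,f$ be odd integers with $$2\le e<a<b<f<\min\left\{\left\lfloor \frac{n2^{\lceil m/2\rceil}}{2^m-1}-1\right\rfloor,\ n-1,\ \lfloor\kappa\rfloor\right\},$$ and put $t=(b-1)/2$ and $w=(e-1)/2$. Let $\alpha$ be a primitive $n$-th root of unity in an extension field of $\mathbb F_2$, and let $M_i(x)$ be the minimal polynomial of $\alpha^i$ over $\mathbb F_2$. Let $C_1,C_2,C_3,C_4$ be the binary narrow-sense BCH codes of length $n$ with generator polynomials $\operatorname{lcm}\{M_1,\dots,M_b\}$, $\operatorname{lcm}\{M_1,\dots,M_a\}$, $\operatorname{lcm}\{M_1,\dots,M_f\}$ and $\operatorname{lcm}\{M_1,\dots,M_e\}$, respectively. Let $d$ be the minimum distance of $C_1+C_3$ and $d^*$ the minimum distance of $C_2+C_4$. Then $d\ge b+1$, $d^*\ge e+1$, $n\ge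 2m(t+1)$, and for every pair of nonnegative integers $(a_l,a_r)$ with $a_l+a_r<m(t-w)$ there exists an $(a_l,a_r)$-$[[\,n+a_l+a_r,\ n-2m(t+1)\,]]$ quantum synchronizable code that corrects up to $\lfloor\frac{d-1}{2}\rfloor$ phase errors and up to $\lfloor\frac{d^*-1}{2}\rfloor$ bit errors. Here an $(a_l,a_r)$-$[[N,k]]$ quantum synchronizable code that corrects up to $p$ phase errors and up to $q$ bit errors is a subspace $Q$ of dimension $2^k$ of the state space of $N$ qubits (a frame) with the following property. Suppose that a frame in a stream of qubits carries a state of $Q$, the adjacent qubits being in any state, that at most $p$ phase errors and at most $q$ bit errors occur in the frame, and that the receiver holds a window of $N$ consecutive qubits of the stream that is misaligned with the frame by an unknown amount, at most $a_l$ qubits to the left or at most $a_r$ qubits to the right. Then there is a procedure, independent of the state, the errors and the misalignment, that consists of a quantum measurement on the window, which determines the misalignment with certainty, followed by a quantum operation on the realigned frame (which may depend on the measurement outcome), and that restores the state the stream had before the errors in the frame. -/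

import Mathlib

open scoped Polynomial

namespace QSync

/-! ### Binary cyclic codes and BCH codes -/

/-- The binary cyclic code of length `n` generated by `g`: the words whose polynomial
`c₀ + c₁ X + ⋯` lies, modulo `X ^ n - 1`, in the ideal generated by `g`. -/
def cyclicCode (n : ℕ) (g : (ZMod 2)[X]) : Submodule (ZMod 2) (Fin n → ZMod 2) where
  carrier := {c | ∑ i, Polynomial.C (c i) * Polynomial.X ^ (i : ℕ) ∈
    Ideal.span {g, Polynomial.X ^ n - 1}}
  zero_mem' := by simp
  add_mem' := by
    intro c c' hc hc'
    simp only [Set.mem_ofPred_eq, Pi.add_apply, map_add, add_mul, Finset.sum_add_distrib] at *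
    exact add_mem hc hc'
  smul_mem' := by
    intro r c hc
    simp only [Set.mem_ofPred_eq, Pi.smul_apply, smul_eq_mul, map_mul, mul_assoc,
      ← Finset.mul_sum] at *
    exact Ideal.mul_mem_left _ _ hc

/-- The polynomial `lcm {M_s, M_{s+1}, …, M_{s+δ-2}}`, where `M_i` is the minimal polynomial
of `α ^ i` over `𝔽₂`. -/
noncomputable def bchGenerator {K : Type*} [Field K] [Algebra (ZMod 2) K] (α : K) (s δ : ℕ) :
    (ZMod 2)[X] :=
  letI : NormalizedGCDMonoid (ZMod 2)[X] :=
    UniqueFactorizationMonoid.toNormalizedGCDMonoid (ZMod 2)[X]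
  (Finset.Icc s (s + δ - 2)).lcm fun i => minpoly (ZMod 2) (α ^ i)

/-- The binary narrow-sense BCH code of length `n` and design distance `δ` with respect to the
primitive `n`-th root of unity `α`. -/
noncomputable def narrowBCH {K : Type*} [Field K] [Algebra (ZMod 2) K] (n : ℕ) (α : K) (δ : ℕ) :
    Submodule (ZMod 2) (Fin n → ZMod 2) :=
  cyclicCode n (bchGenerator α 1 δ)

/-- The minimum distance of a (nonzero) binary linear code. -/
noncomputable def minDist {n : ℕ} (C : Submodule (ZMod 2) (Fin n → ZMod 2)) : ℕ :=
  sInf {d | ∃ c ∈ C, c ≠ 0 ∧ hammingNorm c = d}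

/-! ### Qubits -/

/-- State vectors of a system of qubits labelled by `ι`, given by their coordinates in the
computational basis. -/
abbrev Qubits (ι : Type*) : Type _ := (ι → ZMod 2) → ℂ

/-- Operators on a system of `N` qubits, as matrices in the computational basis. -/
abbrev QOp (N : ℕ) : Type := Matrix (Fin N → ZMod 2) (Fin N → ZMod 2) ℂ

/-- The Pauli operator `X(u) Z(v)`, that is `|y⟩ ↦ (-1)^(v·y) |y + u⟩`: bit errors at the support
of `u` and phase errors at the support of `v`. -/
def pauli {N : ℕ} (u v : Fin N → ZMod 2) : QOp N :=
  fun x y => if x = y + u then (-1) ^ (v ⬝ᵥ y).val else 0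

/-- A family of Kraus operators is complete: `∑ Kᴴ K = 1`. -/
def IsComplete {N r : ℕ} (K : Fin r → QOp N) : Prop :=
  ∑ i, (K i).conjTranspose * K i = 1

/-- The operator `A` on `N` qubits, applied to the qubits `w 0, …, w (N-1)` of a larger system
(and the identity applied to all the others). -/
noncomputable def actOn {ι : Type*} {N : ℕ} (w : Fin N → ι) (A : QOp N) (Φ : Qubits ι) :
    Qubits ι :=
  fun x => ∑ y, A (x ∘ w) y * Φ (Function.extend w y x)

/-- The unnormalised density matrix `|Φ⟩⟨Φ|`. -/
def density {ι : Type*} (Φ : Qubits ι) : Matrix (ι → ZMod 2) (ι → ZMod 2) ℂ :=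
  Matrix.vecMulVec Φ (star Φ)

/-- The joint state `Φ` lies in `Q ⊗ (everything else)`: the `N` qubits `w 0, …, w (N-1)`
carry a state of `Q` (possibly entangled with the other qubits). -/
def Carries {ι : Type*} {N : ℕ} (w : Fin N → ι) (Q : Submodule ℂ (Qubits (Fin N)))
    (Φ : Qubits ι) : Prop :=
  ∀ x, (fun y => Φ (Function.extend w y x)) ∈ Q

/-! ### Quantum synchronizable codes

A frame of `N` qubits sits in a stream of qubits.  We look at the stretch of the stream that
consists of the frame, the `al` qubits before it and the `ar` qubits after it. -/

/-- The positions of the `N` qubits of the true frame in the stretch. -/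
def frame (al ar N : ℕ) : Fin N → Fin (al + N + ar) :=
  fun i => ⟨al + i, by omega⟩

/-- The positions of a block of `N` consecutive qubits that starts at offset `s` in the stretch.
It is the true frame for `s = al`; it is misaligned by `al - s` qubits to the left for `s < al`
and by `s - al` qubits to the right for `s > al`. -/
def window (al ar N : ℕ) (s : Fin (al + ar + 1)) : Fin N → Fin (al + N + ar) :=
  fun i => ⟨s + i, by omega⟩

/-- `Q` is an `(al, ar)-[[N, k]]` quantum synchronizable code that corrects up to `tp` phase errors
and up to `tb` bit errors: `Q` encodes `k` logical qubits into `N` physical qubits, and there is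
a decoding procedure as follows.

The receiver holds a window of `N` consecutive qubits, which is misaligned with the frame by an
unknown amount of at most `al` qubits to the left or at most `ar` qubits to the right. First he
measures the window with Kraus operators `M j`; the outcome `j` yields the estimate `shift j`
of the offset. He then moves to the frame that the estimate indicates and applies a recovery
operation with Kraus operators `R j i`. For every actual offset `s`, every pattern of at most `tb`
bit errors and at most `tp` phase errors in the frame, and every state of the stretch
whose frame is encoded in `Q` (the adjacent qubits, which belong to the neighbouring frames and
their errors, may be in any state), the estimate is correct with certainty and the procedure
restores the state as it was before the errors. -/
def IsQSC (al ar N k tp tb : ℕ) (Q : Submodule ℂ (Qubits (Fin N))) : Prop :=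
  Module.finrank ℂ Q = 2 ^ k ∧
  ∃ (r r' : ℕ) (M : Fin r → QOp N) (shift : Fin r → Fin (al + ar + 1))
    (R : Fin r → Fin r' → QOp N),
    IsComplete M ∧ (∀ j, IsComplete (R j)) ∧
    ∀ (s : Fin (al + ar + 1)) (u v : Fin N → ZMod 2), hammingNorm u ≤ tb → hammingNorm v ≤ tp →
      ∀ Φ : Qubits (Fin (al + N + ar)), Carries (frame al ar N) Q Φ →
        ∑ j with shift j = s, ∑ i,
          density (actOn (frame al ar N) (R j i) (actOn (window al ar N s) (M j)
            (actOn (frame al ar N) (pauli u v) Φ))) = density Φ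

end QSync

namespace QSync

open Matrix

/-! ### Characters of binary vector spaces -/

/-! Let r = (2^m-1)/n. The bound by κ makes i*r small against 2^⌈m/2⌉ for all i ≤ b, and estimates
modulo 2^m-1 then give `cosetBound`: odd i ≤ b lie in distinct cyclotomic cosets of full size m, and
none of these cosets contains the negative of a positive j ≤ b. The first fact gives the generator
of C = C₁ its degree m(t+1). The second says that inverses of the prescribed roots are never roots,
so C contains its dual, whence n ≥ 2m(t+1). By nesting, C₁+C₃ = C and C₂+C₄ = C₄ = D, and the BCH
bound estimates d and d*.

Let g be the generator word of D. The quantum code is the CSS code of the pair C^⊥ ≤ C translated by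
g, all words being extended periodically to length n+al+ar. At every offset s, the n qubits from
position al of the window lie inside the frame and show a word of C+g shifted cyclically by s, up to
bit errors. Since D separates these errors and the shifts of g by s < m(t-w) lie in distinct cosets
of C (`eq_of_cyc_add_cyc_mem`), s is a function of the observed bits, and measuring it does not
disturb the state (`isQSC_cssCode`). The realigned frame is then decoded as a CSS code
(`recovery_mulVec`). `exists_isQSC_of_cyclic` joins these pieces; phase errors are compared there
after folding positions modulo n, because periodicity makes the code degenerate. -/

/-- The nontrivial character of `𝔽₂`. -/
noncomputable def zsign (a : ZMod 2) : ℂ := (-1) ^ a.val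

lemma zsign_zero : zsign 0 = 1 := by simp [zsign]

lemma zsign_one : zsign 1 = -1 := by simp [zsign, ZMod.val_one]

lemma zmod_two_cases (a : ZMod 2) : a = 0 ∨ a = 1 := by
  revert a; decide

lemma zsign_add (a b : ZMod 2) : zsign (a + b) = zsign a * zsign b := by
  have h : (1 : ZMod 2) + 1 = 0 := by decide
  rcases zmod_two_cases a with rfl | rfl <;> rcases zmod_two_cases b with rfl | rfl <;>
    simp [zsign_zero, zsign_one, h]

lemma zsign_mul_self (a : ZMod 2) : zsign a * zsign a = 1 := by
  rcases zmod_two_cases a with rfl | rfl <;> simp [zsign_zero, zsign_one]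

lemma star_zsign (a : ZMod 2) : star (zsign a) = zsign a := by
  rcases zmod_two_cases a with rfl | rfl <;> simp [zsign_zero, zsign_one]

section Sums

variable {N : ℕ}

open Classical in
/-- The indicator function of a binary linear code. -/
noncomputable def ind (B : Submodule (ZMod 2) (Fin N → ZMod 2)) (y : Fin N → ZMod 2) : ℂ :=
  if y ∈ B then 1 else 0

variable (B : Submodule (ZMod 2) (Fin N → ZMod 2))

lemma ind_of_mem {y : Fin N → ZMod 2} (h : y ∈ B) : ind B y = 1 := if_pos h

lemma ind_of_notMem {y : Fin N → ZMod 2} (h : y ∉ B) : ind B y = 0 := if_neg h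

lemma ind_mul_self (y : Fin N → ZMod 2) : ind B y * ind B y = ind B y := by
  by_cases h : y ∈ B <;> simp [ind, h]

lemma star_ind (y : Fin N → ZMod 2) : star (ind B y) = ind B y := by
  by_cases h : y ∈ B <;> simp [ind, h]

lemma ind_add_of_mem {b : Fin N → ZMod 2} (hb : b ∈ B) (y : Fin N → ZMod 2) :
    ind B (y + b) = ind B y := by
  by_cases h : y ∈ B
  · rw [ind_of_mem B h, ind_of_mem B (add_mem h hb)]
  · rw [ind_of_notMem B h, ind_of_notMem B (fun h' => h ((Submodule.add_mem_iff_left B hb).1 h'))]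

lemma ind_congr {y z : Fin N → ZMod 2} (h : y + z ∈ B) : ind B y = ind B z := by
  have : z = y + (y + z) := by rw [← add_assoc, ZModModule.add_self, zero_add]
  rw [this, ind_add_of_mem B h]

lemma sum_ind : ∑ y, ind B y = (Nat.card B : ℂ) := by
  classical
  simp only [ind, Finset.sum_boole, Nat.card_eq_fintype_card, Fintype.card_subtype]

lemma sum_add_right {M : Type*} [AddCommMonoid M] (f : (Fin N → ZMod 2) → M)
    (u : Fin N → ZMod 2) : ∑ y, f (y + u) = ∑ y, f y :=
  Fintype.sum_equiv (Equiv.addRight u) _ _ fun _ => rfl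

-- Orthogonality of characters: translating by a b ∈ B with v·b = 1 changes the sign of the sum.
open Classical in
lemma sum_ind_mul_zsign (v : Fin N → ZMod 2) :
    ∑ y, ind B y * zsign (v ⬝ᵥ y) = if ∀ b ∈ B, v ⬝ᵥ b = 0 then (Nat.card B : ℂ) else 0 := by
  split_ifs with h
  · rw [← sum_ind]
    refine Finset.sum_congr rfl fun y _ => ?_
    by_cases hy : y ∈ B
    · rw [h y hy, zsign_zero, mul_one]
    · rw [ind_of_notMem B hy, zero_mul]
  · push Not at h
    obtain ⟨b, hb, hvb⟩ := h
    have h1 : zsign (v ⬝ᵥ b) = -1 := by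
      rw [(zmod_two_cases _).resolve_left hvb, zsign_one]
    have h2 := sum_add_right (fun y => ind B y * zsign (v ⬝ᵥ y)) b
    simp only [ind_add_of_mem B hb, dotProduct_add, zsign_add, h1, mul_neg, mul_one,
      Finset.sum_neg_distrib] at h2
    exact self_eq_neg.1 h2.symm

lemma sum_zsign (y : Fin N → ZMod 2) :
    ∑ v : Fin N → ZMod 2, zsign (v ⬝ᵥ y) = if y = 0 then (2 : ℂ) ^ N else 0 := by
  have h := sum_ind_mul_zsign (⊤ : Submodule (ZMod 2) (Fin N → ZMod 2)) y
  simp only [ind_of_mem ⊤ Submodule.mem_top, one_mul, Submodule.mem_top, true_imp_iff,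
    dotProduct_eq_zero_iff] at h
  simp only [dotProduct_comm _ y]
  rw [h]
  simp [Nat.card_eq_fintype_card]

-- Double counting of the character sums over B; it amounts to |B^⊥||B| = 2^N and also normalises
-- the recovery operators.
open Classical in
lemma card_dual_mul_card :
    ∑ v : Fin N → ZMod 2, (if ∀ b ∈ B, v ⬝ᵥ b = 0 then (Nat.card B : ℂ) else 0) = 2 ^ N := by
  simp only [← sum_ind_mul_zsign]
  rw [Finset.sum_comm]
  simp only [← Finset.mul_sum, sum_zsign, mul_ite, mul_zero, Finset.sum_ite_eq', Finset.mem_univ,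
    if_true, ind_of_mem B (zero_mem B), one_mul]

end Sums

/-! ### CSS codes on cosets -/

section CSS

variable {N : ℕ}

/-- The CSS code of the pair `B ≤ A`, translated by `g`: the states supported on `A + g` that are
invariant under translation by `B`. -/
def cssCode (A B : Submodule (ZMod 2) (Fin N → ZMod 2)) (g : Fin N → ZMod 2) :
    Submodule ℂ (Qubits (Fin N)) where
  carrier := {φ | (∀ y, y + g ∉ A → φ y = 0) ∧ ∀ b ∈ B, ∀ y, φ (y + b) = φ y}
  zero_mem' := by simp
  add_mem' := by
    rintro φ ψ ⟨h1, h2⟩ ⟨h3, h4⟩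
    exact ⟨fun y hy => by simp [h1 y hy, h3 y hy], fun b hb y => by simp [h2 b hb, h4 b hb]⟩
  smul_mem' := by
    rintro c φ ⟨h1, h2⟩
    exact ⟨fun y hy => by simp [h1 y hy], fun b hb y => by simp [h2 b hb]⟩

open Classical in
/-- A coset leader of weight at most `k` of the coset `u + H`, if there is one. -/
noncomputable def leader (H : Submodule (ZMod 2) (Fin N → ZMod 2)) (k : ℕ)
    (u : Fin N → ZMod 2) : Fin N → ZMod 2 :=
  if h : ∃ u', hammingNorm u' ≤ k ∧ u' + u ∈ H then h.choose else u

lemma leader_add_mem (H : Submodule (ZMod 2) (Fin N → ZMod 2)) (k : ℕ) (u : Fin N → ZMod 2) :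
    leader H k u + u ∈ H := by
  unfold leader
  split_ifs with h
  · exact h.choose_spec.2
  · rw [ZModModule.add_self]; exact zero_mem H

lemma hammingNorm_leader_le (H : Submodule (ZMod 2) (Fin N → ZMod 2)) (k : ℕ)
    {u u' : Fin N → ZMod 2} (hk : hammingNorm u' ≤ k) (h : u' + u ∈ H) :
    hammingNorm (leader H k u) ≤ k := by
  have h' : ∃ u', hammingNorm u' ≤ k ∧ u' + u ∈ H := ⟨u', hk, h⟩
  unfold leader
  rw [dif_pos h']
  exact h'.choose_spec.1

/-- The dual code. -/
def dualCode (B : Submodule (ZMod 2) (Fin N → ZMod 2)) :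
    Submodule (ZMod 2) (Fin N → ZMod 2) where
  carrier := {v | ∀ b ∈ B, v ⬝ᵥ b = 0}
  zero_mem' := by simp
  add_mem' := by
    intro v v' h h' b hb
    rw [add_dotProduct, h b hb, h' b hb, add_zero]
  smul_mem' := by
    intro c v h b hb
    rw [smul_dotProduct, h b hb, smul_zero]

lemma mem_dualCode {B : Submodule (ZMod 2) (Fin N → ZMod 2)} {v : Fin N → ZMod 2} :
    v ∈ dualCode B ↔ ∀ b ∈ B, v ⬝ᵥ b = 0 := Iff.rfl

/-- Projection to the code after undoing the Pauli error `X(U) Z(V)`. -/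
noncomputable def undo (A B : Submodule (ZMod 2) (Fin N → ZMod 2)) (g : Fin N → ZMod 2) (c : ℝ)
    (U V : Fin N → ZMod 2) : QOp N :=
  fun x y => c * (ind A (x + g) * ind B (x + (y + U)) * zsign (V ⬝ᵥ (y + U)))

lemma natCard_cast_pos (B : Submodule (ZMod 2) (Fin N → ZMod 2)) : 0 < (Nat.card B : ℝ) :=
  Nat.cast_pos.2 Nat.card_pos

/-- An intermediate x contributes only if it lies in y + U + B. As B ≤ A, the condition on A is then
the same for all these x, so the sum over x gives the factor |B|. -/
lemma undo_gram {A B : Submodule (ZMod 2) (Fin N → ZMod 2)} (hBA : B ≤ A) (g : Fin N → ZMod 2)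
    (c : ℝ) (U V y y' : Fin N → ZMod 2) :
    ((undo A B g c U V).conjTranspose * undo A B g c U V) y y' =
      c ^ 2 * Nat.card B * (ind A (y + U + g) * (ind B (y + y') * zsign (V ⬝ᵥ (y + y')))) := by
  have key : ∀ x, (undo A B g c U V).conjTranspose y x * undo A B g c U V x y' =
      c ^ 2 * (ind A (y + U + g) * (ind B (y + y') * zsign (V ⬝ᵥ (y + y')))) *
        ind B (x + (y + U)) := by
    intro x
    simp only [conjTranspose_apply, undo, star_mul', star_ind, star_zsign]
    rw [show star (c : ℂ) = c from Complex.conj_ofReal c]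
    by_cases hx : x + (y + U) ∈ B
    · have h1 : ind A (x + g) = ind A (y + U + g) := by
        refine ind_congr A ?_
        rw [show x + g + (y + U + g) = x + (y + U) + (g + g) by abel,
          ZModModule.add_self, add_zero]
        exact hBA hx
      have h2 : ind B (x + (y' + U)) = ind B (y + y') := by
        refine ind_congr B ?_
        rwa [show x + (y' + U) + (y + y') = x + (y + U) + (y' + y') by abel,
          ZModModule.add_self, add_zero]
      have h3 : zsign (V ⬝ᵥ (y + y')) = zsign (V ⬝ᵥ (y + U)) * zsign (V ⬝ᵥ (y' + U)) := by
        rw [← zsign_add, ← dotProduct_add,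
          show y + U + (y' + U) = y + y' + (U + U) by abel, ZModModule.add_self, add_zero]
      rw [h1, h2, h3, ind_of_mem B hx]
      linear_combination (c ^ 2 * zsign (V ⬝ᵥ (y + U)) * ind B (y + y') *
        zsign (V ⬝ᵥ (y' + U))) * ind_mul_self A (y + U + g)
    · rw [ind_of_notMem B hx]; ring
  rw [mul_apply]
  simp only [key]
  rw [← Finset.mul_sum, sum_add_right (fun x => ind B x), sum_ind]
  ring

/-- The recovery operators of a CSS code: one for each Pauli operator, built from the leader of its
coset. -/
noncomputable def recovery (A B : Submodule (ZMod 2) (Fin N → ZMod 2)) (g : Fin N → ZMod 2)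
    (tb tp : ℕ) (p : (Fin N → ZMod 2) × (Fin N → ZMod 2)) : QOp N :=
  undo A B g (Real.sqrt (Nat.card A * Nat.card B * 2 ^ N))⁻¹ (leader A tb p.1)
    (leader (dualCode B) tp p.2)

lemma recovery_coeff_sq (A B : Submodule (ZMod 2) (Fin N → ZMod 2)) :
    (((Real.sqrt (Nat.card A * Nat.card B * 2 ^ N))⁻¹ : ℝ) : ℂ) ^ 2 * Nat.card B * Nat.card A *
      2 ^ N = 1 := by
  have hA := natCard_cast_pos A
  have hB := natCard_cast_pos B
  have h : ((Real.sqrt (Nat.card A * Nat.card B * 2 ^ N))⁻¹) ^ 2 * Nat.card B * Nat.card A *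
      2 ^ N = (1 : ℝ) := by
    rw [inv_pow, Real.sq_sqrt (by positivity)]
    field_simp
  exact_mod_cast h

/-- A Gram matrix depends only on the cosets of the two labels, so leaders may be replaced by the
labels themselves. Summing over all u gives |A|; summing over all v gives 2^N on the diagonal and 0
elsewhere. -/
lemma sum_recovery {A B : Submodule (ZMod 2) (Fin N → ZMod 2)} (hBA : B ≤ A)
    (g : Fin N → ZMod 2) (tb tp : ℕ) :
    ∑ p, (recovery A B g tb tp p).conjTranspose * recovery A B g tb tp p = 1 := by
  ext y y'
  rw [Matrix.sum_apply]
  simp only [recovery, undo_gram hBA]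
  have h1 : ∀ u, ind A (y + leader A tb u + g) = ind A (u + (y + g)) := by
    intro u
    refine ind_congr A ?_
    rw [show y + leader A tb u + g + (u + (y + g)) = leader A tb u + u + (y + y) + (g + g) by abel,
      ZModModule.add_self, ZModModule.add_self, add_zero, add_zero]
    exact leader_add_mem A tb u
  have h2 : ∀ v, ind B (y + y') * zsign (leader (dualCode B) tp v ⬝ᵥ (y + y')) =
      ind B (y + y') * zsign (v ⬝ᵥ (y + y')) := by
    intro v
    by_cases hy : y + y' ∈ B
    · have := leader_add_mem (dualCode B) tp v (y + y') hy
      rw [add_dotProduct, CharTwo.add_eq_zero] at this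
      rw [this]
    · rw [ind_of_notMem B hy, zero_mul, zero_mul]
  simp only [h1, h2]
  rw [Fintype.sum_prod_type]
  simp only [← Finset.mul_sum, ← Finset.sum_mul]
  rw [sum_add_right (fun u => ind A u), sum_ind, sum_zsign, one_apply]
  by_cases hy : y = y'
  · subst hy
    rw [ZModModule.add_self, if_pos rfl, if_pos rfl, ind_of_mem B (zero_mem B)]
    linear_combination recovery_coeff_sq A B
  · rw [if_neg hy, if_neg (fun h => hy (by
      rw [← add_zero y, ← h, ← add_assoc, ZModModule.add_self, zero_add]))]
    ring

open Classical in
/-- The factor by which a recovery operator acts on a code state damaged by a correctable error. -/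
noncomputable def recoveryFactor (A B : Submodule (ZMod 2) (Fin N → ZMod 2))
    (u v : Fin N → ZMod 2) (p : (Fin N → ZMod 2) × (Fin N → ZMod 2)) : ℂ :=
  ((Real.sqrt (Nat.card A * Nat.card B * 2 ^ N))⁻¹ : ℝ) *
    (ind A (p.1 + u) * if ∀ b ∈ B, (p.2 + v) ⬝ᵥ b = 0 then (Nat.card B : ℂ) else 0)

lemma sum_recoveryFactor (A B : Submodule (ZMod 2) (Fin N → ZMod 2)) (u v : Fin N → ZMod 2) :
    ∑ p, recoveryFactor A B u v p * star (recoveryFactor A B u v p) = 1 := by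
  classical
  obtain ⟨D, hD⟩ : ∃ D : (Fin N → ZMod 2) → ℂ, ∀ w, D w =
    if ∀ b ∈ B, w ⬝ᵥ b = 0 then (Nat.card B : ℂ) else 0 := ⟨_, fun _ => rfl⟩
  have key : ∀ p, recoveryFactor A B u v p * star (recoveryFactor A B u v p) =
      (((Real.sqrt (Nat.card A * Nat.card B * 2 ^ N))⁻¹ : ℝ) : ℂ) ^ 2 * Nat.card B *
        (ind A (p.1 + u) * D (p.2 + v)) := by
    intro p
    rw [hD]
    simp only [recoveryFactor, star_mul', star_ind]
    rw [show ∀ c : ℝ, star (c : ℂ) = c from Complex.conj_ofReal]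
    have h := ind_mul_self A (p.1 + u)
    split_ifs with hp
    · rw [star_natCast]
      linear_combination ((((Real.sqrt (Nat.card A * Nat.card B * 2 ^ N))⁻¹ : ℝ) : ℂ) ^ 2 *
        Nat.card B * Nat.card B) * h
    · simp
  simp only [key]
  rw [← Finset.mul_sum, Fintype.sum_prod_type]
  simp only [← Finset.mul_sum, ← Finset.sum_mul]
  rw [sum_add_right (fun y => ind A y), sum_ind, sum_add_right D]
  have h : ∑ w, D w = 2 ^ N := by
    rw [← card_dual_mul_card B]
    exact Finset.sum_congr rfl fun w _ => hD w
  rw [h]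
  linear_combination recovery_coeff_sq A B

lemma pauli_mulVec_apply (u v : Fin N → ZMod 2) (φ : Qubits (Fin N)) (y : Fin N → ZMod 2) :
    (pauli u v *ᵥ φ) y = zsign (v ⬝ᵥ (y + u)) * φ (y + u) := by
  have hy : ∀ z, y = z + u ↔ z = y + u := fun z => by
    constructor <;> rintro rfl <;> rw [add_assoc, ZModModule.add_self, add_zero]
  simp only [mulVec, dotProduct, pauli, hy, ite_mul, zero_mul, Finset.sum_ite_eq',
    Finset.mem_univ, if_true]
  rfl

lemma sum_undo_mul_pauli (A B : Submodule (ZMod 2) (Fin N → ZMod 2)) (g : Fin N → ZMod 2) (c : ℝ)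
    (U V u v x : Fin N → ZMod 2) (φ : Qubits (Fin N)) :
    (undo A B g c U V *ᵥ (pauli u v *ᵥ φ)) x =
      ∑ z, c * (ind A (x + g) * ind B (x + (z + u + U)) * zsign (V ⬝ᵥ (z + u + U))) *
        (zsign (v ⬝ᵥ z) * φ z) := by
  rw [mulVec, dotProduct, ← sum_add_right _ u]
  refine Finset.sum_congr rfl fun z _ => ?_
  have hz : z + u + u = z := by rw [add_assoc, ZModModule.add_self, add_zero]
  rw [pauli_mulVec_apply, hz, undo]

/-- On a code state with a correctable error, each recovery operator restores the state up to
a factor. -/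
lemma recovery_mulVec {A B : Submodule (ZMod 2) (Fin N → ZMod 2)} (hBA : B ≤ A)
    {g : Fin N → ZMod 2} {tb tp : ℕ}
    (hbit : ∀ u u', hammingNorm u ≤ tb → hammingNorm u' ≤ tb → u + u' ∈ A → u = u')
    (hphase : ∀ v v', hammingNorm v ≤ tp → hammingNorm v' ≤ tp → v + v' ∈ dualCode B →
      ∀ x, x + g ∈ A → (v + v') ⬝ᵥ x = 0)
    {u v : Fin N → ZMod 2} (hu : hammingNorm u ≤ tb) (hv : hammingNorm v ≤ tp)
    {φ : Qubits (Fin N)} (hφ : φ ∈ cssCode A B g) (p : (Fin N → ZMod 2) × (Fin N → ZMod 2)) :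
    recovery A B g tb tp p *ᵥ (pauli u v *ᵥ φ) = recoveryFactor A B u v p • φ := by
  classical
  obtain ⟨p1, p2⟩ := p
  obtain ⟨hsupp, hinv⟩ := hφ
  ext x
  rw [recovery, sum_undo_mul_pauli, Pi.smul_apply, smul_eq_mul, recoveryFactor]
  dsimp only
  set c : ℝ := (Real.sqrt (Nat.card A * Nat.card B * 2 ^ N))⁻¹
  set U := leader A tb p1 with hU
  set V := leader (dualCode B) tp p2 with hV
  have hUp : U + p1 ∈ A := leader_add_mem A tb p1
  by_cases hxA : x + g ∈ A
  swap
  · rw [hsupp x hxA, mul_zero]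
    refine Finset.sum_eq_zero fun z _ => ?_
    rw [ind_of_notMem A hxA]; ring
  -- If p1 + u ∉ A, the syndrome is wrong: a nonzero term would have x and z in A + g and x + z + u
  -- + U in B, which forces p1 + u ∈ A.
  by_cases hup : p1 + u ∈ A
  swap
  · rw [ind_of_notMem A hup]
    simp only [zero_mul, mul_zero]
    refine Finset.sum_eq_zero fun z _ => ?_
    by_cases hz : z + g ∈ A
    · rw [ind_of_notMem B]
      · ring
      intro hB
      apply hup
      have h1 := add_mem (add_mem (add_mem (hBA hB) hxA) hz) hUp
      rwa [show x + (z + u + U) + (x + g) + (z + g) + (U + p1) =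
        p1 + u + (x + x) + (z + z) + (U + U) + (g + g) by abel, ZModModule.add_self,
        ZModModule.add_self, ZModModule.add_self, ZModModule.add_self, add_zero,
        add_zero, add_zero, add_zero] at h1
    · rw [hsupp z hz]; ring
  have hUu : U = u := by
    refine hbit _ _ (hammingNorm_leader_le A tb hu (by rwa [add_comm])) hu ?_
    have h1 := add_mem hUp hup
    rwa [show U + p1 + (p1 + u) = U + u + (p1 + p1) by abel, ZModModule.add_self,
      add_zero] at h1
  have hx2 : ∀ z, z + u + U = z := fun z => by
    rw [hUu, add_assoc, ZModModule.add_self, add_zero]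
  simp only [hx2]
  have hVp : V + p2 ∈ dualCode B := leader_add_mem (dualCode B) tp p2
  rw [← sum_ind_mul_zsign, ind_of_mem A hup, ind_of_mem A hxA, ← sum_add_right _ x, one_mul,
    Finset.mul_sum, Finset.sum_mul]
  have hVv : ∀ b ∈ B, (p2 + v) ⬝ᵥ b = (V + v) ⬝ᵥ b := by
    intro b hb
    have h1 := hVp b hb
    rw [add_dotProduct, CharTwo.add_eq_zero] at h1
    rw [add_dotProduct, add_dotProduct, h1]
  have hxx : ∀ y, x + (y + x) = y := fun y => by
    rw [add_left_comm, ZModModule.add_self, add_zero]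
  -- If p2 + v lies in the dual of B, then V and v may differ but give equal signs on A + g, so each
  -- b ∈ B contributes one copy of φ x. Otherwise p2 + v is a nontrivial character of B and the sum
  -- vanishes.
  by_cases hdual : p2 + v ∈ dualCode B
  · refine Finset.sum_congr rfl fun b _ => ?_
    rw [hxx]
    by_cases hb : b ∈ B
    · have hVtp : hammingNorm V ≤ tp := by
        refine hammingNorm_leader_le (dualCode B) tp hv ?_
        rwa [add_comm]
      have hVvd : V + v ∈ dualCode B := fun b hb => by rw [← hVv b hb]; exact hdual b hb
      have h0 : V ⬝ᵥ (b + x) = v ⬝ᵥ (b + x) := by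
        rw [← CharTwo.add_eq_zero, ← add_dotProduct]
        refine hphase V v hVtp hv hVvd _ ?_
        rw [add_assoc]
        exact add_mem (hBA hb) hxA
      rw [add_comm b x, hinv b hb, add_comm x b, h0, hdual b hb, zsign_zero]
      linear_combination (c * ind B b * φ x) * zsign_mul_self (v ⬝ᵥ (b + x))
    · rw [ind_of_notMem B hb]; ring
  · have h0 : ∑ b, ind B b * zsign ((p2 + v) ⬝ᵥ b) = 0 := by
      rw [sum_ind_mul_zsign]; exact if_neg hdual
    have h1 : ∀ b, c * (1 * ind B (x + (b + x)) * zsign (V ⬝ᵥ (b + x))) *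
        (zsign (v ⬝ᵥ (b + x)) * φ (b + x)) =
        c * zsign ((V + v) ⬝ᵥ x) * φ x * (ind B b * zsign ((p2 + v) ⬝ᵥ b)) := by
      intro b
      rw [hxx]
      by_cases hb : b ∈ B
      · rw [hVv b hb, add_comm b x, hinv b hb, dotProduct_add, dotProduct_add, zsign_add,
          zsign_add, add_dotProduct, add_dotProduct, zsign_add, zsign_add]
        ring
      · rw [ind_of_notMem B hb]; ring
    simp only [h1]
    rw [← Finset.mul_sum, ← Finset.sum_mul, ← Finset.mul_sum, h0]
    ring

end CSS

end QSync

namespace QSync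

open Matrix

/-! ### Operators on part of a larger system. -/

section Stretch

variable {ι : Type*} {N : ℕ}

lemma extend_comp_self {w : Fin N → ι} (hw : Function.Injective w) (x : ι → ZMod 2) :
    Function.extend w (x ∘ w) x = x := by
  ext i
  by_cases h : ∃ j, w j = i
  · obtain ⟨j, rfl⟩ := h
    rw [hw.extend_apply]; rfl
  · rw [Function.extend_apply' _ _ _ h]

lemma extend_extend {w : Fin N → ι} (hw : Function.Injective w) (y z : Fin N → ZMod 2)
    (x : ι → ZMod 2) : Function.extend w z (Function.extend w y x) = Function.extend w z x := by
  ext i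
  by_cases h : ∃ j, w j = i
  · obtain ⟨j, rfl⟩ := h
    rw [hw.extend_apply, hw.extend_apply]
  · rw [Function.extend_apply' _ _ _ h, Function.extend_apply' _ _ _ h,
      Function.extend_apply' _ _ _ h]

/-- An operator acts on each slice of the joint state. -/
lemma actOn_apply (w : Fin N → ι) (A : QOp N) (Φ : Qubits ι) (x : ι → ZMod 2) :
    actOn w A Φ x = (A *ᵥ fun y => Φ (Function.extend w y x)) (x ∘ w) := rfl

lemma actOn_slice {w : Fin N → ι} (hw : Function.Injective w) (A : QOp N) (Φ : Qubits ι)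
    (x : ι → ZMod 2) : (fun y => actOn w A Φ (Function.extend w y x)) =
      A *ᵥ fun y => Φ (Function.extend w y x) := by
  ext y
  simp only [actOn_apply, extend_extend hw, Function.extend_comp hw]

lemma actOn_diagonal {w : Fin N → ι} (hw : Function.Injective w) (d : (Fin N → ZMod 2) → ℂ)
    (Φ : Qubits ι) (x : ι → ZMod 2) :
    actOn w (Matrix.diagonal d) Φ x = d (x ∘ w) * Φ x := by
  rw [actOn_apply, Matrix.mulVec_diagonal, extend_comp_self hw]

lemma density_smul (c : ℂ) (Φ : Qubits ι) : density (c • Φ) = (c * star c) • density Φ := by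
  ext x y
  simp only [density, vecMulVec_apply, Pi.smul_apply, Pi.star_apply, smul_eq_mul, star_mul',
    Matrix.smul_apply]
  ring

end Stretch

/-! ### Dimension of the CSS code: code states are functions on A/B. -/

section Dimension

variable {N : ℕ}

open Classical in
/-- The code state given by a function on the cosets of `B` in `A`. -/
noncomputable def cosetState (A B : Submodule (ZMod 2) (Fin N → ZMod 2)) (g : Fin N → ZMod 2) :
    ((A ⧸ B.submoduleOf A) → ℂ) →ₗ[ℂ] Qubits (Fin N) where
  toFun f y := if h : y + g ∈ A then f (Submodule.Quotient.mk ⟨y + g, h⟩) else 0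
  map_add' f f' := by
    ext y
    by_cases h : y + g ∈ A <;> simp [h]
  map_smul' c f := by
    ext y
    by_cases h : y + g ∈ A <;> simp [h]

lemma cosetState_apply {A B : Submodule (ZMod 2) (Fin N → ZMod 2)} {g : Fin N → ZMod 2}
    (f : (A ⧸ B.submoduleOf A) → ℂ) {y : Fin N → ZMod 2} (h : y + g ∈ A) :
    cosetState A B g f y = f (Submodule.Quotient.mk ⟨y + g, h⟩) := dif_pos h

lemma cosetState_apply_of_notMem {A B : Submodule (ZMod 2) (Fin N → ZMod 2)}
    {g : Fin N → ZMod 2} (f : (A ⧸ B.submoduleOf A) → ℂ) {y : Fin N → ZMod 2} (h : y + g ∉ A) :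
    cosetState A B g f y = 0 := dif_neg h

lemma cosetState_injective (A B : Submodule (ZMod 2) (Fin N → ZMod 2)) (g : Fin N → ZMod 2) :
    Function.Injective (cosetState A B g) := by
  intro f f' h
  ext q
  obtain ⟨⟨a, ha⟩, rfl⟩ := Submodule.Quotient.mk_surjective _ q
  have hg : a + g + g = a := by rw [add_assoc, ZModModule.add_self, add_zero]
  have h1 := congrFun h (a + g)
  rw [cosetState_apply f (by rwa [hg]), cosetState_apply f' (by rwa [hg])] at h1
  simpa only [hg] using h1

lemma range_cosetState {A B : Submodule (ZMod 2) (Fin N → ZMod 2)} (hBA : B ≤ A)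
    (g : Fin N → ZMod 2) : LinearMap.range (cosetState A B g) = cssCode A B g := by
  apply le_antisymm
  · rintro _ ⟨f, rfl⟩
    refine ⟨fun y hy => cosetState_apply_of_notMem f hy, fun b hb y => ?_⟩
    have hiff : y + b + g ∈ A ↔ y + g ∈ A := by
      rw [add_right_comm]; exact Submodule.add_mem_iff_left A (hBA hb)
    by_cases hy : y + g ∈ A
    · rw [cosetState_apply f hy, cosetState_apply f (hiff.2 hy)]
      congr 1
      rw [Submodule.Quotient.eq, Submodule.submoduleOf, Submodule.mem_comap]
      simpa [add_right_comm] using hb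
    · rw [cosetState_apply_of_notMem f hy, cosetState_apply_of_notMem f (fun h => hy (hiff.1 h))]
  · rintro φ ⟨h1, h2⟩
    refine ⟨fun q => φ (q.out.1 + g), ?_⟩
    ext y
    by_cases hy : y + g ∈ A
    · rw [cosetState_apply _ hy]
      have h3 := Submodule.Quotient.mk_out (Submodule.Quotient.mk (p := B.submoduleOf A) ⟨y + g, hy⟩)
      rw [Submodule.Quotient.eq, Submodule.submoduleOf, Submodule.mem_comap] at h3
      have h4 := h2 _ h3 y
      rw [← h4]
      congr 1
      rw [map_sub, Submodule.subtype_apply, Submodule.subtype_apply, ZModModule.sub_eq_add]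
      rw [add_left_comm, ← add_assoc y y, ZModModule.add_self, zero_add]
      rfl
    · rw [h1 y hy, cosetState_apply_of_notMem _ hy]

lemma finrank_cssCode {A B : Submodule (ZMod 2) (Fin N → ZMod 2)} (hBA : B ≤ A)
    (g : Fin N → ZMod 2) {k : ℕ} (hk : Nat.card A = 2 ^ k * Nat.card B) :
    Module.finrank ℂ (cssCode A B g) = 2 ^ k := by
  classical
  rw [← range_cosetState hBA, LinearMap.finrank_range_of_inj (cosetState_injective A B g)]
  have : Fintype (A ⧸ B.submoduleOf A) := Fintype.ofFinite _
  rw [Module.finrank_fintype_fun_eq_card, ← Nat.card_eq_fintype_card]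
  have h1 := Submodule.card_eq_card_quotient_mul_card (B.submoduleOf A)
  have h2 : Nat.card (B.submoduleOf A) = Nat.card B :=
    Nat.card_congr (Submodule.submoduleOfEquivOfLe hBA).toEquiv
  rw [h2, hk] at h1
  rw [mul_comm] at h1
  exact (Nat.eq_of_mul_eq_mul_left Nat.card_pos h1).symm

end Dimension

lemma frame_injective (al ar N : ℕ) : Function.Injective (frame al ar N) := by
  intro i j h
  simpa [frame, Fin.ext_iff] using h

lemma window_injective (al ar N : ℕ) (s : Fin (al + ar + 1)) :
    Function.Injective (window al ar N s) := by
  intro i j h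
  simpa [window, Fin.ext_iff] using h

/-- A CSS code on cosets that corrects the errors and whose words, even with bit errors, show
the offset of the window, is quantum synchronizable. -/
theorem isQSC_cssCode {al ar N k tp tb : ℕ} {A B : Submodule (ZMod 2) (Fin N → ZMod 2)}
    (hBA : B ≤ A) {g : Fin N → ZMod 2}
    (hbit : ∀ u u', hammingNorm u ≤ tb → hammingNorm u' ≤ tb → u + u' ∈ A → u = u')
    (hphase : ∀ v v', hammingNorm v ≤ tp → hammingNorm v' ≤ tp → v + v' ∈ dualCode B →
      ∀ x, x + g ∈ A → (v + v') ⬝ᵥ x = 0)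
    (hk : Nat.card A = 2 ^ k * Nat.card B)
    (est : (Fin N → ZMod 2) → Fin (al + ar + 1))
    (hest : ∀ s u, hammingNorm u ≤ tb → ∀ x : Fin (al + N + ar) → ZMod 2,
      x ∘ frame al ar N + u + g ∈ A → est (x ∘ window al ar N s) = s) :
    IsQSC al ar N k tp tb (cssCode A B g) := by
  classical
  refine ⟨finrank_cssCode hBA g hk, al + ar + 1, _,
    -- A projective measurement of the function `est` in the computational basis; the recovery need
    -- not depend on its outcome.
    fun s => Matrix.diagonal fun y => if est y = s then 1 else 0, id,
    fun _ i => recovery A B g tb tp ((Fintype.equivFin _).symm i), ?_, ?_, ?_⟩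
  · unfold IsComplete
    simp only [diagonal_conjTranspose, diagonal_mul_diagonal]
    ext y y'
    rw [Matrix.sum_apply]
    by_cases h : y = y'
    · subst h
      simp only [diagonal_apply_eq, Pi.star_apply, one_apply_eq]
      rw [Finset.sum_eq_single (est y)] <;> simp +contextual [eq_comm]
    · simp [h]
  · intro _
    unfold IsComplete
    rw [Equiv.sum_comp (Fintype.equivFin _).symm
      (fun p => (recovery A B g tb tp p).conjTranspose * recovery A B g tb tp p)]
    exact sum_recovery hBA g tb tp
  · intro s u v hu hv Φ hΦ
    have hfr := frame_injective al ar N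
    -- Every basis state with nonzero amplitude in the damaged stretch has estimate s, and phase
    -- errors do not alter this support; so the projection for s fixes the state.
    have hmeas : actOn (window al ar N s)
        (Matrix.diagonal fun y => if est y = s then (1 : ℂ) else 0)
        (actOn (frame al ar N) (pauli u v) Φ) = actOn (frame al ar N) (pauli u v) Φ := by
      ext x
      rw [actOn_diagonal (window_injective al ar N s)]
      by_cases hx : x ∘ frame al ar N + u + g ∈ A
      · rw [if_pos (hest s u hu x hx), one_mul]
      · rw [actOn_apply, pauli_mulVec_apply]
        have h0 := (hΦ x).1 _ hx
        dsimp only at h0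
        rw [h0, mul_zero, mul_zero]
    have hrec : ∀ p, actOn (frame al ar N) (recovery A B g tb tp p)
        (actOn (frame al ar N) (pauli u v) Φ) = recoveryFactor A B u v p • Φ := by
      intro p
      ext x
      rw [actOn_apply, actOn_slice hfr, recovery_mulVec hBA hbit hphase hu hv (hΦ x) p,
        Pi.smul_apply, Pi.smul_apply, extend_comp_self hfr]
    simp only [id, Finset.filter_eq', Finset.mem_univ, if_true, Finset.sum_singleton]
    rw [hmeas]
    simp only [hrec, density_smul]
    rw [← Finset.sum_smul, Equiv.sum_comp (Fintype.equivFin _).symm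
      (fun p => recoveryFactor A B u v p * star (recoveryFactor A B u v p)),
      sum_recoveryFactor, one_smul]

end QSync

namespace QSync

open Polynomial

/-! ### Arithmetic modulo `2 ^ m - 1` -/

/-- From (I+2)*2^⌊m/2⌋ ≤ 2^m one has I*2^⌊m/2⌋ ≤ 2^m - 2*2^⌊m/2⌋ ≤ 2^m - 2^⌈m/2⌉, which leaves room
for J + 1. -/
lemma small_mul_two_pow_add_lt {m l I J : ℕ} (hl : l ≤ m / 2)
    (hI : I + 2 ≤ 2 ^ ((m + 1) / 2)) (hJ : J + 2 ≤ 2 ^ ((m + 1) / 2)) :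
    I * 2 ^ l + J + 1 < 2 ^ m := by
  have h1 : 2 ^ m = 2 ^ ((m + 1) / 2) * 2 ^ (m / 2) := by
    rw [← pow_add]; congr 1; omega
  have h2 : 2 ^ ((m + 1) / 2) ≤ 2 * 2 ^ (m / 2) := by
    rw [← pow_succ']; exact Nat.pow_le_pow_right (by norm_num) (by omega)
  have h3 : (2 : ℕ) ^ l ≤ 2 ^ (m / 2) := Nat.pow_le_pow_right (by norm_num) hl
  have h4 : I * 2 ^ l ≤ I * 2 ^ (m / 2) := Nat.mul_le_mul_left _ h3
  have h5 : (I + 2) * 2 ^ (m / 2) ≤ 2 ^ ((m + 1) / 2) * 2 ^ (m / 2) := Nat.mul_le_mul_right _ hI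
  rw [h1]
  linarith

lemma two_pow_modEq (m : ℕ) : 2 ^ m ≡ 1 [MOD 2 ^ m - 1] :=
  ((Nat.modEq_iff_dvd' Nat.one_le_two_pow).2 dvd_rfl).symm

/-- Exponents matter only modulo m. For a residue at most m/2 the sum is positive and below the
modulus; a larger one becomes small on multiplying by 2^(m-l), which exchanges I and J. -/
lemma not_dvd_mul_two_pow_add {m I J : ℕ} (hm : 0 < m) (hJ0 : 0 < J) (hI0 : 0 < I)
    (hI : I + 2 ≤ 2 ^ ((m + 1) / 2)) (hJ : J + 2 ≤ 2 ^ ((m + 1) / 2)) (l : ℕ) :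
    ¬ 2 ^ m - 1 ∣ I * 2 ^ l + J := by
  have small : ∀ {I J l : ℕ}, 0 < J → I + 2 ≤ 2 ^ ((m + 1) / 2) → J + 2 ≤ 2 ^ ((m + 1) / 2) →
      l ≤ m / 2 → ¬ 2 ^ m - 1 ∣ I * 2 ^ l + J := by
    intro I J l hJ0 hI hJ hl h
    have h1 := Nat.le_of_dvd (by positivity) h
    have h2 := small_mul_two_pow_add_lt hl hI hJ
    omega
  have red : 2 ^ l ≡ 2 ^ (l % m) [MOD 2 ^ m - 1] := by
    conv_lhs => rw [← Nat.div_add_mod l m, pow_add, pow_mul]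
    simpa using ((two_pow_modEq m).pow (l / m)).mul_right (2 ^ (l % m))
  intro h
  have h' : 2 ^ m - 1 ∣ I * 2 ^ (l % m) + J :=
    (((red.mul_left I).add_right J).dvd_iff dvd_rfl).1 h
  have hlm := Nat.mod_lt l hm
  by_cases hl : l % m ≤ m / 2
  · exact small hJ0 hI hJ hl h'
  · have h1 : 2 ^ m - 1 ∣ (I * 2 ^ (l % m) + J) * 2 ^ (m - l % m) := h'.mul_right _
    have h2 : (I * 2 ^ (l % m) + J) * 2 ^ (m - l % m) = J * 2 ^ (m - l % m) + I * 2 ^ m := by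
      have : 2 ^ m = 2 ^ (l % m) * 2 ^ (m - l % m) := by rw [← pow_add]; congr 1; omega
      rw [this]; ring
    rw [h2] at h1
    have h3 : J * 2 ^ (m - l % m) + I * 2 ^ m ≡ J * 2 ^ (m - l % m) + I [MOD 2 ^ m - 1] := by
      simpa using ((two_pow_modEq m).mul_left I).add_left (J * 2 ^ (m - l % m))
    exact small hI0 hJ hI (by omega) ((h3.dvd_iff dvd_rfl).1 h1)

/-- For l ≤ m/2 both sides are below the modulus, hence equal as integers, and parity forces l = 0.
For larger l, the same argument with I and J exchanged gives m - l = 0, which is impossible. -/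
lemma eq_of_mul_two_pow_modEq {m I J l : ℕ} (hIo : Odd I) (hJo : Odd J)
    (hI : I + 2 ≤ 2 ^ ((m + 1) / 2)) (hJ : J + 2 ≤ 2 ^ ((m + 1) / 2)) (hl : l < m)
    (h : I * 2 ^ l ≡ J [MOD 2 ^ m - 1]) : l = 0 ∧ I = J := by
  have small : ∀ {I J l : ℕ}, Odd J → I + 2 ≤ 2 ^ ((m + 1) / 2) → J + 2 ≤ 2 ^ ((m + 1) / 2) →
      l ≤ m / 2 → I * 2 ^ l ≡ J [MOD 2 ^ m - 1] → l = 0 ∧ I = J := by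
    intro I J l hJo hI hJ hl h
    have h2 := small_mul_two_pow_add_lt hl hI hJ
    have h3 : I * 2 ^ l = J := h.eq_of_lt_of_lt (by omega) (by omega)
    have h4 : l = 0 := by
      by_contra hl0
      have : Even J := by
        rw [← h3]; exact ((Nat.even_pow.2 ⟨even_two, hl0⟩)).mul_left I
      exact (Nat.not_even_iff_odd.2 hJo) this
    subst h4
    exact ⟨rfl, by simpa using h3⟩
  by_cases hlm : l ≤ m / 2
  · exact small hJo hI hJ hlm h
  · have h1 := h.mul_right (2 ^ (m - l))
    rw [mul_assoc, ← pow_add, Nat.add_sub_cancel' hl.le] at h1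
    have h2 : J * 2 ^ (m - l) ≡ I [MOD 2 ^ m - 1] :=
      h1.symm.trans (by simpa using (two_pow_modEq m).mul_left I)
    have := (small hIo hJ hI (by omega) h2).1
    omega

/-- No two members of the range `1, …, b` are related by `i * 2 ^ l ≡ -j`, and odd members lie in
distinct cyclotomic cosets of full size `m`. -/
structure CosetBound (n m b : ℕ) : Prop where
  not_dvd : ∀ i j l, 0 < i → i ≤ b → 0 < j → j ≤ b → ¬ n ∣ i * 2 ^ l + j
  inj : ∀ i j l, Odd i → i ≤ b → Odd j → j ≤ b → l < m → i * 2 ^ l ≡ j [MOD n] → l = 0 ∧ i = j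

/-- Multiplying by r turns relations modulo n into relations modulo 2^m - 1; since r is odd, i*r
keeps the parity of i. -/
lemma cosetBound {n m b r : ℕ} (hm : 0 < m) (hr : n * r = 2 ^ m - 1)
    (hb : b * r + 2 ≤ 2 ^ ((m + 1) / 2)) : CosetBound n m b := by
  have hro : Odd r := by
    have h1 : Odd (2 ^ m - 1) :=
      Nat.Even.sub_odd Nat.one_le_two_pow (Nat.even_pow.2 ⟨even_two, hm.ne'⟩) odd_one
    rw [← hr] at h1
    exact (Nat.odd_mul.1 h1).2
  have hr0 : 0 < r := hro.pos
  have hbd : ∀ {i}, i ≤ b → i * r + 2 ≤ 2 ^ ((m + 1) / 2) := fun hi =>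
    (Nat.add_le_add_right (Nat.mul_le_mul_right r hi) 2).trans hb
  constructor
  · intro i j l hi hib hj hjb h
    have h1 := mul_dvd_mul_right h r
    rw [hr, show (i * 2 ^ l + j) * r = i * r * 2 ^ l + j * r by ring] at h1
    exact not_dvd_mul_two_pow_add hm (by positivity) (by positivity) (hbd hib) (hbd hjb) l h1
  · intro i j l hi hib hj hjb hl h
    have h1 := h.mul_right' r
    rw [hr, show i * 2 ^ l * r = i * r * 2 ^ l by ring] at h1
    obtain ⟨h2, h3⟩ :=
      eq_of_mul_two_pow_modEq (hi.mul hro) (hj.mul hro) (hbd hib) (hbd hjb) hl h1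
    exact ⟨h2, Nat.eq_of_mul_eq_mul_right hr0 h3⟩

/-! ### Words as polynomials -/

/-- The polynomial of a word. -/
noncomputable def wordPoly {n : ℕ} (c : Fin n → ZMod 2) : (ZMod 2)[X] :=
  ∑ i, C (c i) * X ^ (i : ℕ)

section Words

variable {n : ℕ} {K : Type*} [Field K] [Algebra (ZMod 2) K]

lemma wordPoly_add (c c' : Fin n → ZMod 2) : wordPoly (c + c') = wordPoly c + wordPoly c' := by
  simp [wordPoly, add_mul, Finset.sum_add_distrib]

lemma wordPoly_smul (r : ZMod 2) (c : Fin n → ZMod 2) : wordPoly (r • c) = r • wordPoly c := by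
  simp [wordPoly, mul_assoc, Finset.smul_sum, smul_eq_C_mul]

lemma aeval_wordPoly (γ : K) (c : Fin n → ZMod 2) :
    aeval γ (wordPoly c) = ∑ i, algebraMap (ZMod 2) K (c i) * γ ^ (i : ℕ) := by
  simp [wordPoly]

lemma exists_wordPoly_eq {p : (ZMod 2)[X]} (hp : p.natDegree < n) :
    ∃ c : Fin n → ZMod 2, wordPoly c = p := by
  refine ⟨fun i => p.coeff i, ?_⟩
  conv_rhs => rw [p.as_sum_range' n hp]
  simp only [wordPoly, C_mul_X_pow_eq_monomial]
  exact Fin.sum_univ_eq_sum_range (fun i => monomial i (p.coeff i)) n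

variable [NeZero n]

/-- The cyclic shift of a word by `s` positions to the left. -/
def cyc (c : Fin n → ZMod 2) (s : ℕ) : Fin n → ZMod 2 := fun i => c (i + Fin.ofNat n s)

lemma cyc_apply (c : Fin n → ZMod 2) (s : ℕ) (i : Fin n) :
    cyc c s i = c ⟨(s + i) % n, Nat.mod_lt _ (NeZero.pos n)⟩ := by
  unfold cyc
  congr 1
  ext
  simp [Fin.val_add, add_comm]

/-- A left shift by s is multiplication by X^(-s) modulo X^n - 1. -/
lemma pow_mul_aeval_cyc {γ : K} (hγ : γ ^ n = 1) (c : Fin n → ZMod 2) (s : ℕ) :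
    γ ^ s * aeval γ (wordPoly (cyc c s)) = aeval γ (wordPoly c) := by
  rw [aeval_wordPoly, aeval_wordPoly, Finset.mul_sum]
  conv_rhs => rw [← Equiv.sum_comp (Equiv.addRight (Fin.ofNat n s))]
  refine Finset.sum_congr rfl fun i _ => ?_
  have h : γ ^ ((i + Fin.ofNat n s : Fin n) : ℕ) = γ ^ s * γ ^ (i : ℕ) := by
    rw [← pow_add, Fin.val_add, Fin.val_ofNat, Nat.add_mod_mod, add_comm s]
    exact (pow_eq_pow_mod _ hγ).symm
  simp only [Equiv.coe_addRight, h, cyc]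
  ring

-- The product equals ∑ γ^k (x · `cyc c k`): its coefficients are the cyclic correlations of x and
-- c.
open Matrix in
lemma aeval_inv_mul_aeval {γ : K} (hγ : γ ^ n = 1) {x c : Fin n → ZMod 2}
    (h : ∀ s, x ⬝ᵥ cyc c s = 0) :
    aeval γ⁻¹ (wordPoly x) * aeval γ (wordPoly c) = 0 := by
  have hγ0 : γ ≠ 0 := by
    rintro rfl
    rw [zero_pow (NeZero.ne n)] at hγ
    exact zero_ne_one hγ
  have h1 : ∑ k : Fin n, γ ^ (k : ℕ) * algebraMap (ZMod 2) K (x ⬝ᵥ cyc c k) = 0 :=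
    Finset.sum_eq_zero fun k _ => by rw [h, map_zero, mul_zero]
  rw [← h1, aeval_wordPoly, Finset.sum_mul]
  simp only [dotProduct, map_sum, map_mul, Finset.mul_sum]
  rw [Finset.sum_comm]
  refine Finset.sum_congr rfl fun i _ => ?_
  rw [← pow_mul_aeval_cyc hγ c i, aeval_wordPoly, Finset.mul_sum, Finset.mul_sum]
  refine Finset.sum_congr rfl fun k _ => ?_
  have h2 : γ⁻¹ ^ (i : ℕ) * γ ^ (i : ℕ) = 1 := by rw [← mul_pow, inv_mul_cancel₀ hγ0, one_pow]
  rw [cyc_apply, cyc_apply]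
  simp only [add_comm (k : ℕ) (i : ℕ)]
  linear_combination (algebraMap (ZMod 2) K (x i) * γ ^ (k : ℕ) *
    algebraMap (ZMod 2) K (c ⟨((i : ℕ) + k) % n, Nat.mod_lt _ (NeZero.pos n)⟩)) * h2

end Words

/-! ### Narrow-sense BCH codes -/

lemma pow_eq_pow_iff_of_isPrimitiveRoot {n : ℕ} {K : Type*} [Field K] {α : K}
    (hα : IsPrimitiveRoot α n) (hn : n ≠ 0) {i j : ℕ} : α ^ i = α ^ j ↔ i ≡ j [MOD n] := by
  have h : IsOfFinOrder α :=
    isOfFinOrder_iff_pow_eq_one.2 ⟨n, Nat.pos_of_ne_zero hn, hα.pow_eq_one⟩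
  rw [h.pow_eq_pow_iff_modEq, ← hα.eq_orderOf]

lemma pow_pow_eq_one_of_isPrimitiveRoot {n : ℕ} {K : Type*} [Field K] {α : K}
    (hα : IsPrimitiveRoot α n) (i : ℕ) : (α ^ i) ^ n = 1 := by
  rw [← pow_mul, mul_comm, pow_mul, hα.pow_eq_one, one_pow]

section BCH

variable {n : ℕ} {K : Type*} [Field K] [Algebra (ZMod 2) K] {α : K}

lemma isIntegral_pow_root (hα : IsPrimitiveRoot α n) (hn : 0 < n) (i : ℕ) :
    IsIntegral (ZMod 2) (α ^ i) :=
  (hα.isIntegral hn).tower_top.pow i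

lemma mem_narrowBCH (hα : IsPrimitiveRoot α n) {b : ℕ} {c : Fin n → ZMod 2} :
    c ∈ narrowBCH n α (b + 1) ↔ ∀ i, 0 < i → i ≤ b → aeval (α ^ i) (wordPoly c) = 0 := by
  have hIcc : ∀ i, i ∈ Finset.Icc 1 (1 + (b + 1) - 2) ↔ 0 < i ∧ i ≤ b := fun i => by
    rw [Finset.mem_Icc]; omega
  change wordPoly c ∈ Ideal.span {bchGenerator α 1 (b + 1), X ^ n - 1} ↔ _
  constructor
  · intro h i hi hib
    obtain ⟨p, q, hpq⟩ := Ideal.mem_span_pair.1 h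
    have h1 : minpoly (ZMod 2) (α ^ i) ∣ bchGenerator α 1 (b + 1) :=
      letI : NormalizedGCDMonoid (ZMod 2)[X] :=
        UniqueFactorizationMonoid.toNormalizedGCDMonoid (ZMod 2)[X]
      Finset.dvd_lcm ((hIcc i).2 ⟨hi, hib⟩)
    obtain ⟨g, hg⟩ := h1
    have h2 := pow_pow_eq_one_of_isPrimitiveRoot hα i
    rw [← hpq, hg]
    simp [h2]
  · intro h
    have h1 : bchGenerator α 1 (b + 1) ∣ wordPoly c :=
      letI : NormalizedGCDMonoid (ZMod 2)[X] :=
        UniqueFactorizationMonoid.toNormalizedGCDMonoid (ZMod 2)[X]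
      Finset.lcm_dvd fun i hi => minpoly.dvd _ _ (h i ((hIcc i).1 hi).1 ((hIcc i).1 hi).2)
    exact Ideal.mem_of_dvd _ h1 (Ideal.subset_span (Set.mem_insert _ _))

lemma narrowBCH_anti (hα : IsPrimitiveRoot α n) {b b' : ℕ} (h : b ≤ b') :
    narrowBCH n α (b' + 1) ≤ narrowBCH n α (b + 1) := fun _ hc =>
  (mem_narrowBCH hα).2 fun i hi hib => (mem_narrowBCH hα).1 hc i hi (hib.trans h)

lemma cyc_mem_narrowBCH [NeZero n] (hα : IsPrimitiveRoot α n) {b : ℕ} {c : Fin n → ZMod 2}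
    (hc : c ∈ narrowBCH n α (b + 1)) (s : ℕ) : cyc c s ∈ narrowBCH n α (b + 1) := by
  rw [mem_narrowBCH hα] at hc ⊢
  intro i hi hib
  have h2 := pow_pow_eq_one_of_isPrimitiveRoot hα i
  have h1 := pow_mul_aeval_cyc h2 c s
  rw [hc i hi hib] at h1
  exact (mul_eq_zero.1 h1).resolve_left (pow_ne_zero _ (pow_ne_zero _ (hα.ne_zero (NeZero.ne n))))

/-- The BCH bound. -/
lemma lt_hammingNorm_of_mem_narrowBCH (hα : IsPrimitiveRoot α n) {b : ℕ} {c : Fin n → ZMod 2}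
    (hc : c ∈ narrowBCH n α (b + 1)) (h0 : c ≠ 0) : b < hammingNorm c := by
  classical
  rw [mem_narrowBCH hα] at hc
  by_contra! hle
  obtain ⟨i0, hi0⟩ := Function.ne_iff.1 h0
  have hn : n ≠ 0 := fun h => by subst h; exact i0.elim0
  set S : Finset (Fin n) := Finset.univ.filter fun i => c i ≠ 0 with hS
  have hi0S : i0 ∈ S := by simpa [hS] using hi0
  -- L vanishes at all support points except α^i0, and its degree is the weight, at most b. The
  -- factor X removes the constant term, so only the vanishing values of c at α, …, α^b enter the
  -- sum below.
  set L : K[X] := X * ∏ i ∈ S.erase i0, (X - C (α ^ (i : ℕ))) with hL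
  have hdeg : L.natDegree ≤ b := by
    refine le_trans ?_ hle
    refine natDegree_mul_le.trans ?_
    rw [natDegree_X, natDegree_prod_of_monic _ _ fun i _ => monic_X_sub_C _]
    simp only [natDegree_X_sub_C, Finset.sum_const, smul_eq_mul, mul_one]
    rw [Finset.card_erase_of_mem hi0S]
    have : 0 < S.card := Finset.card_pos.2 ⟨i0, hi0S⟩
    have h2 : S.card = hammingNorm c := rfl
    omega
  have hsum : ∑ i, algebraMap (ZMod 2) K (c i) * L.eval (α ^ (i : ℕ)) = 0 := by
    simp only [eval_eq_sum_range' (Nat.lt_succ_of_le hdeg), Finset.mul_sum]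
    rw [Finset.sum_comm]
    refine Finset.sum_eq_zero fun l hl => ?_
    rcases Nat.eq_zero_or_pos l with rfl | hl0
    · simp [hL, mul_coeff_zero]
    · have h1 := hc l hl0 (Nat.lt_succ_iff.1 (Finset.mem_range.1 hl))
      rw [aeval_wordPoly] at h1
      have h2 : ∀ i : Fin n, algebraMap (ZMod 2) K (c i) * (L.coeff l * (α ^ (i : ℕ)) ^ l) =
          L.coeff l * (algebraMap (ZMod 2) K (c i) * (α ^ l) ^ (i : ℕ)) := fun i => by
        rw [← pow_mul, ← pow_mul, mul_comm l]; ring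
      simp only [h2]
      rw [← Finset.mul_sum, h1, mul_zero]
  rw [Finset.sum_eq_single i0] at hsum
  · have h1 : algebraMap (ZMod 2) K (c i0) ≠ 0 := by
      rwa [Ne, FaithfulSMul.algebraMap_eq_zero_iff]
    have h2 := (mul_eq_zero.1 hsum).resolve_left h1
    simp only [hL, eval_mul, eval_X, eval_prod, eval_sub, eval_C, mul_eq_zero,
      Finset.prod_eq_zero_iff, sub_eq_zero] at h2
    rcases h2 with h2 | ⟨i, hi, h2⟩
    · exact pow_ne_zero _ (hα.ne_zero hn) h2
    · have := hα.pow_inj i0.2 i.2 h2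
      exact (Finset.mem_erase.1 hi).1 (Fin.ext this.symm)
  · intro i _ hi
    by_cases hci : c i = 0
    · rw [hci, map_zero, zero_mul]
    · have : L.eval (α ^ (i : ℕ)) = 0 := by
        simp only [hL, eval_mul, eval_prod, eval_sub, eval_X, eval_C]
        rw [Finset.prod_eq_zero (i := i) _ (sub_self _), mul_zero]
        rw [Finset.mem_erase]
        exact ⟨hi, by simpa [hS] using hci⟩
      rw [this, mul_zero]
  · simp

lemma le_minDist {C : Submodule (ZMod 2) (Fin n → ZMod 2)} {d : ℕ}
    (hne : ∃ c ∈ C, c ≠ 0) (h : ∀ c ∈ C, c ≠ 0 → d ≤ hammingNorm c) : d ≤ minDist C := by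
  obtain ⟨c, hc, h0⟩ := hne
  obtain ⟨c', hc', h0', hd⟩ := Nat.sInf_mem
    (⟨_, c, hc, h0, rfl⟩ : {d | ∃ c ∈ C, c ≠ 0 ∧ hammingNorm c = d}.Nonempty)
  rw [minDist, ← hd]
  exact h c' hc' h0'

lemma eq_zero_of_hammingNorm_lt {C : Submodule (ZMod 2) (Fin n → ZMod 2)} {c : Fin n → ZMod 2}
    (hc : c ∈ C) (h : hammingNorm c < minDist C) : c = 0 := by
  by_contra h0
  exact (Nat.sInf_le ⟨c, hc, h0, rfl⟩ : minDist C ≤ hammingNorm c).not_gt h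

lemma aeval_pow_two_pow (γ : K) (p : (ZMod 2)[X]) (l : ℕ) :
    aeval (γ ^ 2 ^ l) p = aeval γ p ^ 2 ^ l := by
  have : CharP K 2 := charP_of_injective_algebraMap (algebraMap (ZMod 2) K).injective 2
  induction l with
  | zero => simp
  | succ l ih =>
    rw [pow_succ, pow_mul, pow_mul, ← ih, ← expand_aeval, ZMod.expand_card, map_pow]

/-- The product of the minimal polynomials of `α, α³, …, α^(2t+1)`. -/
noncomputable def oddGenerator (α : K) (t : ℕ) : (ZMod 2)[X] :=
  ∏ j ∈ Finset.range (t + 1), minpoly (ZMod 2) (α ^ (2 * j + 1))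

variable {m b : ℕ}

/-- The degree is the order o of 2 modulo the order of α^i, so o divides m. If o < m, then i*2^o ≡ i
modulo n would contradict `CosetBound.inj`. -/
lemma natDegree_minpoly_pow (hα : IsPrimitiveRoot α n) (hn : n ≠ 0) (hodd : Nat.Coprime n 2)
    (hm : m = orderOf (2 : ZMod n)) (hH : CosetBound n m b) {i : ℕ} (hi : Odd i) (hib : i ≤ b) :
    (minpoly (ZMod 2) (α ^ i)).natDegree = m := by
  have hint := isIntegral_pow_root hα (Nat.pos_of_ne_zero hn) i
  set k := orderOf (α ^ i) with hk
  have hkn : k ∣ n := by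
    rw [orderOf_dvd_iff_pow_eq_one, pow_pow_eq_one_of_isPrimitiveRoot hα]
  have hk0 : 0 < k := Nat.pos_of_dvd_of_pos hkn (Nat.pos_of_ne_zero hn)
  have hprim : IsPrimitiveRoot (α ^ i) k := IsPrimitiveRoot.orderOf _
  have hk2 : Nat.Coprime 2 k := (Nat.Coprime.coprime_dvd_left hkn hodd).symm
  have hdvd : minpoly (ZMod 2) (α ^ i) ∣ cyclotomic k (ZMod 2) := by
    refine minpoly.dvd _ _ ?_
    rw [aeval_def, ← eval_map, map_cyclotomic]
    exact hprim.isRoot_cyclotomic hk0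
  have h1 := natDegree_of_dvd_cyclotomic_of_irreducible (K := ZMod 2) (p := 2) (f := 1)
    (by simp) hk2 hdvd (minpoly.irreducible hint)
  rw [h1]
  set o := orderOf (ZMod.unitOfCoprime (2 ^ 1) (hk2.pow_left 1)) with ho
  have ho1 : ∀ l, o ∣ l ↔ 2 ^ l ≡ 1 [MOD k] := by
    intro l
    rw [ho, orderOf_dvd_iff_pow_eq_one, ← Units.val_inj, ← ZMod.natCast_eq_natCast_iff]
    simp
  have hm1 : ∀ l, m ∣ l ↔ 2 ^ l ≡ 1 [MOD n] := by
    intro l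
    rw [hm, orderOf_dvd_iff_pow_eq_one, ← ZMod.natCast_eq_natCast_iff]
    simp
  have hom : o ∣ m := (ho1 m).2 (((hm1 m).1 dvd_rfl).of_dvd hkn)
  have ho0 : 0 < o := by
    have : NeZero k := ⟨hk0.ne'⟩
    exact orderOf_pos _
  have hm0 : 0 < m := by
    have : NeZero n := ⟨hn⟩
    have h2 : IsUnit (2 : ZMod n) := by
      simpa using (ZMod.unitOfCoprime 2 hodd.symm).isUnit
    obtain ⟨u, hu⟩ := h2
    rw [hm, ← hu, orderOf_units]
    exact orderOf_pos _
  by_contra hne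
  have holt : o < m := lt_of_le_of_ne (Nat.le_of_dvd hm0 hom) hne
  have h2 : (α ^ i) ^ 2 ^ o = (α ^ i) ^ 1 :=
    (pow_eq_pow_iff_of_isPrimitiveRoot hprim hk0.ne').2 ((ho1 o).1 dvd_rfl)
  rw [← pow_mul, pow_one, pow_eq_pow_iff_of_isPrimitiveRoot hα hn] at h2
  exact ho0.ne' (hH.inj i i o hi hib hi hib holt h2).1

/-- The m conjugates α^(i*2^l) are distinct roots of a polynomial of degree m, hence exhaust its
roots. -/
lemma exists_of_aeval_minpoly_eq_zero (hα : IsPrimitiveRoot α n) (hn : n ≠ 0)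
    (hodd : Nat.Coprime n 2) (hm : m = orderOf (2 : ZMod n)) (hH : CosetBound n m b) {i : ℕ}
    (hi : Odd i) (hib : i ≤ b) {y : K} (hy : aeval y (minpoly (ZMod 2) (α ^ i)) = 0) :
    ∃ l < m, y = α ^ (i * 2 ^ l) := by
  classical
  have hint := isIntegral_pow_root hα (Nat.pos_of_ne_zero hn) i
  have h0 := minpoly.ne_zero hint
  set R := ((minpoly (ZMod 2) (α ^ i)).aroots K).toFinset with hR
  set S := (Finset.range m).image fun l => α ^ (i * 2 ^ l) with hS
  have hSR : S ⊆ R := by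
    intro z hz
    obtain ⟨l, -, rfl⟩ := Finset.mem_image.1 hz
    rw [hR, Multiset.mem_toFinset, mem_aroots]
    refine ⟨h0, ?_⟩
    rw [pow_mul, aeval_pow_two_pow, minpoly.aeval, zero_pow (by positivity)]
  have hinj : Set.InjOn (fun l => α ^ (i * 2 ^ l)) (Finset.range m : Set ℕ) := by
    have key : ∀ l l', l ≤ l' → l' < m → α ^ (i * 2 ^ l) = α ^ (i * 2 ^ l') → l = l' := by
      intro l l' hle hl' h
      rw [pow_eq_pow_iff_of_isPrimitiveRoot hα hn, ← Nat.add_sub_of_le hle, pow_add, mul_comm i,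
        mul_left_comm i, mul_comm i] at h
      have h1 : i ≡ 2 ^ (l' - l) * i [MOD n] :=
        Nat.ModEq.cancel_left_of_coprime (hodd.pow_right l) h
      rw [mul_comm] at h1
      have := (hH.inj i i (l' - l) hi hib hi hib (by omega) h1.symm).1
      omega
    intro l hl l' hl' h
    rcases le_total l l' with hle | hle
    · exact key l l' hle (Finset.mem_range.1 hl') h
    · exact (key l' l hle (Finset.mem_range.1 hl) h.symm).symm
  have hcard : R.card ≤ S.card := by
    rw [hS, Finset.card_image_of_injOn hinj, Finset.card_range,
      ← natDegree_minpoly_pow hα hn hodd hm hH hi hib]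
    refine (Multiset.toFinset_card_le _).trans ((card_roots' _).trans natDegree_map_le)
  have hyR : y ∈ R := by
    rw [hR, Multiset.mem_toFinset, mem_aroots]; exact ⟨h0, hy⟩
  rw [← Finset.eq_of_subset_of_card_le hSR hcard] at hyR
  obtain ⟨l, hl, rfl⟩ := Finset.mem_image.1 hyR
  exact ⟨l, Finset.mem_range.1 hl, rfl⟩

variable {t : ℕ}

/-- Frobenius carries roots with odd exponent to those with even exponent. Conversely, the minimal
polynomials for odd exponents are pairwise coprime, because their cosets are distinct. -/
lemma oddGenerator_dvd_iff (hα : IsPrimitiveRoot α n) (hn : n ≠ 0) (hodd : Nat.Coprime n 2)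
    (hm : m = orderOf (2 : ZMod n)) (hH : CosetBound n m b) (hb : b = 2 * t + 1)
    {p : (ZMod 2)[X]} :
    oddGenerator α t ∣ p ↔ ∀ i, 0 < i → i ≤ b → aeval (α ^ i) p = 0 := by
  constructor
  · intro h i hi hib
    obtain ⟨l, q, hq, rfl⟩ := Nat.exists_eq_two_pow_mul_odd hi.ne'
    obtain ⟨j, rfl⟩ := hq
    have hj : j ∈ Finset.range (t + 1) := by
      rw [Finset.mem_range]
      have : 2 * j + 1 ≤ 2 ^ l * (2 * j + 1) := Nat.le_mul_of_pos_left _ (by positivity)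
      omega
    have h1 := (Finset.dvd_prod_of_mem (fun j => minpoly (ZMod 2) (α ^ (2 * j + 1))) hj).trans h
    rw [mul_comm, pow_mul, aeval_pow_two_pow,
      aeval_eq_zero_of_dvd_aeval_eq_zero h1 (minpoly.aeval _ _), zero_pow (by positivity)]
  · intro h
    refine Finset.prod_dvd_of_coprime ?_ ?_
    · intro j hj j' hj' hne
      rw [Finset.coe_range, Set.mem_Iio] at hj hj'
      have hint := isIntegral_pow_root hα (Nat.pos_of_ne_zero hn) (2 * j + 1)
      have hint' := isIntegral_pow_root hα (Nat.pos_of_ne_zero hn) (2 * j' + 1)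
      refine ((minpoly.irreducible hint).coprime_iff_not_dvd).2 fun hd => hne ?_
      have heq := (minpoly.irreducible hint).associated_of_dvd (minpoly.irreducible hint') hd
      have h1 : aeval (α ^ (2 * j' + 1)) (minpoly (ZMod 2) (α ^ (2 * j + 1))) = 0 :=
        aeval_eq_zero_of_dvd_aeval_eq_zero heq.symm.dvd (minpoly.aeval _ _)
      obtain ⟨l, hl, h2⟩ := exists_of_aeval_minpoly_eq_zero hα hn hodd hm hH
        (odd_two_mul_add_one j) (by omega) h1
      rw [pow_eq_pow_iff_of_isPrimitiveRoot hα hn] at h2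
      have := (hH.inj _ _ l (odd_two_mul_add_one j) (by omega) (odd_two_mul_add_one j') (by omega)
        hl h2.symm).2
      omega
    · intro j hj
      rw [Finset.mem_range] at hj
      exact minpoly.dvd _ _ (h _ (by omega) (by omega))

lemma natDegree_oddGenerator (hα : IsPrimitiveRoot α n) (hn : n ≠ 0) (hodd : Nat.Coprime n 2)
    (hm : m = orderOf (2 : ZMod n)) (hH : CosetBound n m b) (hb : b = 2 * t + 1) :
    (oddGenerator α t).natDegree = m * (t + 1) := by
  rw [oddGenerator, natDegree_prod_of_monic _ _ fun j _ =>
    minpoly.monic (isIntegral_pow_root hα (Nat.pos_of_ne_zero hn) _),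
    Finset.sum_congr rfl fun j hj => natDegree_minpoly_pow hα hn hodd hm hH
      (odd_two_mul_add_one j) (by rw [Finset.mem_range] at hj; omega)]
  simp [mul_comm]

lemma monic_oddGenerator (hα : IsPrimitiveRoot α n) (hn : n ≠ 0) : (oddGenerator α t).Monic :=
  monic_prod_of_monic _ _ fun _ _ => minpoly.monic (isIntegral_pow_root hα (Nat.pos_of_ne_zero hn) _)

/-- A root α^(-j) would equal some α^(i*2^l), so n would divide i*2^l + j. -/
lemma aeval_inv_oddGenerator_ne_zero (hα : IsPrimitiveRoot α n) (hn : n ≠ 0)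
    (hodd : Nat.Coprime n 2) (hm : m = orderOf (2 : ZMod n)) (hH : CosetBound n m b)
    (hb : b = 2 * t + 1) {j : ℕ} (hj : 0 < j) (hjb : j ≤ b) :
    aeval (α ^ j)⁻¹ (oddGenerator α t) ≠ 0 := by
  intro h
  rw [oddGenerator, map_prod, Finset.prod_eq_zero_iff] at h
  obtain ⟨i, hi, h⟩ := h
  rw [Finset.mem_range] at hi
  obtain ⟨l, -, h1⟩ := exists_of_aeval_minpoly_eq_zero hα hn hodd hm hH
    (odd_two_mul_add_one i) (by omega) h
  refine hH.not_dvd (2 * i + 1) j l (by omega) (by omega) hj hjb ?_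
  rw [← hα.pow_eq_one_iff_dvd, pow_add, ← h1, inv_mul_cancel₀ (pow_ne_zero _ (hα.ne_zero hn))]

lemma oddGenerator_dvd_X_pow_sub_one (hα : IsPrimitiveRoot α n) (hn : n ≠ 0)
    (hodd : Nat.Coprime n 2) (hm : m = orderOf (2 : ZMod n)) (hH : CosetBound n m b)
    (hb : b = 2 * t + 1) : oddGenerator α t ∣ X ^ n - 1 := by
  rw [oddGenerator_dvd_iff hα hn hodd hm hH hb]
  intro i _ _
  simp [pow_pow_eq_one_of_isPrimitiveRoot hα]

/-- The inverse of α is a root of X^n - 1 but not of the generator, so the cofactor is not constant.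
Hence the generator is itself the polynomial of a word of length n. -/
lemma natDegree_oddGenerator_lt (hα : IsPrimitiveRoot α n) (hn : n ≠ 0)
    (hodd : Nat.Coprime n 2) (hm : m = orderOf (2 : ZMod n)) (hH : CosetBound n m b)
    (hb : b = 2 * t + 1) : (oddGenerator α t).natDegree < n := by
  obtain ⟨q, hq⟩ := oddGenerator_dvd_X_pow_sub_one hα hn hodd hm hH hb
  have h1 := aeval_inv_oddGenerator_ne_zero hα hn hodd hm hH hb one_pos (by omega)
  have hX : (X ^ n - 1 : (ZMod 2)[X]) ≠ 0 := X_pow_sub_C_ne_zero (Nat.pos_of_ne_zero hn) 1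
  have hd : (X ^ n - 1 : (ZMod 2)[X]).natDegree = n := natDegree_X_pow_sub_C
  rw [hq] at hX
  have hq0 : q ≠ 0 := right_ne_zero_of_mul hX
  rw [hq, natDegree_mul (left_ne_zero_of_mul hX) hq0] at hd
  have hqd : q.natDegree ≠ 0 := by
    intro h
    obtain ⟨c, rfl⟩ := natDegree_eq_zero.1 h
    have h2 := congrArg (aeval (α ^ 1)⁻¹) hq
    simp only [pow_one, map_sub, map_pow, aeval_X, map_one, inv_pow, hα.pow_eq_one, inv_one,
      sub_self, map_mul, aeval_C] at h2
    rcases mul_eq_zero.1 h2.symm with h3 | h3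
    · exact h1 (by simpa using h3)
    · rw [FaithfulSMul.algebraMap_eq_zero_iff] at h3
      exact hq0 (by rw [h3, C_0])
  omega

end BCH

end QSync

namespace QSync

open Polynomial Matrix

/-! ### Dual codes -/

lemma card_dualCode_mul_card {n : ℕ} (B : Submodule (ZMod 2) (Fin n → ZMod 2)) :
    Nat.card (dualCode B) * Nat.card B = 2 ^ n := by
  classical
  have h := card_dual_mul_card B
  rw [← Finset.sum_filter, Finset.sum_const, nsmul_eq_mul] at h
  have h1 : (Finset.univ.filter fun v : Fin n → ZMod 2 => ∀ b ∈ B, v ⬝ᵥ b = 0).card =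
      Nat.card (dualCode B) := by
    rw [Nat.card_eq_fintype_card, Fintype.card_subtype]
    congr 1
    ext v
    simp [mem_dualCode]
  rw [h1] at h
  exact_mod_cast h

lemma dualCode_dualCode {n : ℕ} (B : Submodule (ZMod 2) (Fin n → ZMod 2)) :
    dualCode (dualCode B) = B := by
  symm
  apply SetLike.coe_injective
  refine Set.eq_of_subset_of_ncard_le (fun b hb v hv => ?_) ?_ (Set.toFinite _)
  · rw [dotProduct_comm]; exact hv b hb
  · have h1 := card_dualCode_mul_card B
    have h2 := card_dualCode_mul_card (dualCode B)
    rw [← h1, mul_comm] at h2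
    exact (Nat.eq_of_mul_eq_mul_left Nat.card_pos h2).le

/-! ### Size, dual containment and minimum distance of BCH codes. -/

section BCH

variable {n : ℕ} {K : Type*} [Field K] [Algebra (ZMod 2) K] {α : K} {m b t : ℕ}

/-- The code is the kernel of reduction modulo the generator, which maps words onto a quotient ring
of dimension m(t+1). -/
lemma card_narrowBCH (hα : IsPrimitiveRoot α n) (hn : n ≠ 0) (hodd : Nat.Coprime n 2)
    (hm : m = orderOf (2 : ZMod n)) (hH : CosetBound n m b) (hb : b = 2 * t + 1) :
    Nat.card (narrowBCH n α (b + 1)) = 2 ^ (n - m * (t + 1)) := by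
  have hdeg := natDegree_oddGenerator hα hn hodd hm hH hb
  have hlt := natDegree_oddGenerator_lt hα hn hodd hm hH hb
  have hmon : (oddGenerator α t).Monic := monic_oddGenerator hα hn
  set φ : (Fin n → ZMod 2) →ₗ[ZMod 2] AdjoinRoot (oddGenerator α t) :=
    { toFun := fun c => AdjoinRoot.mk _ (wordPoly c)
      map_add' := fun c c' => by rw [wordPoly_add, map_add]
      map_smul' := fun r c => by
        rw [wordPoly_smul, RingHom.id_apply, AdjoinRoot.smul_mk] } with hφ
  have hker : LinearMap.ker φ = narrowBCH n α (b + 1) := by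
    ext c
    rw [LinearMap.mem_ker, mem_narrowBCH hα, ← oddGenerator_dvd_iff hα hn hodd hm hH hb]
    exact AdjoinRoot.mk_eq_zero
  have hsurj : LinearMap.range φ = ⊤ := by
    rw [LinearMap.range_eq_top]
    intro z
    obtain ⟨p, rfl⟩ := AdjoinRoot.mk_surjective z
    obtain ⟨c, hc⟩ := exists_wordPoly_eq (n := n) (p := p %ₘ oddGenerator α t) (by
      by_cases h1 : oddGenerator α t = 1
      · rw [h1, modByMonic_one, natDegree_zero]; omega
      · exact (natDegree_modByMonic_lt _ hmon h1).trans hlt)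
    refine ⟨c, ?_⟩
    change AdjoinRoot.mk _ (wordPoly c) = _
    rw [hc, AdjoinRoot.mk_eq_mk]
    exact dvd_modByMonic_sub p _
  have hfin := (AdjoinRoot.powerBasis hmon.ne_zero).finrank
  rw [AdjoinRoot.powerBasis_dim, hdeg] at hfin
  have hrank := LinearMap.finrank_range_add_finrank_ker φ
  rw [hsurj, finrank_top, hfin, hker, Module.finrank_fin_fun] at hrank
  rw [Module.natCard_eq_pow_finrank (K := ZMod 2), Nat.card_zmod]
  congr 1
  omega

/-- A dual word x is orthogonal to every shift of the generator word c, so x(α^i) c(α^(-i)) = 0, and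
the second factor is nonzero. -/
lemma dualCode_narrowBCH_le (hα : IsPrimitiveRoot α n) (hn : n ≠ 0) (hodd : Nat.Coprime n 2)
    (hm : m = orderOf (2 : ZMod n)) (hH : CosetBound n m b) (hb : b = 2 * t + 1) :
    dualCode (narrowBCH n α (b + 1)) ≤ narrowBCH n α (b + 1) := by
  have : NeZero n := ⟨hn⟩
  intro x hx
  rw [mem_narrowBCH hα]
  intro i hi hib
  obtain ⟨c, hc⟩ := exists_wordPoly_eq (natDegree_oddGenerator_lt hα hn hodd hm hH hb)
  have hcC : c ∈ narrowBCH n α (b + 1) := by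
    rw [mem_narrowBCH hα, ← oddGenerator_dvd_iff hα hn hodd hm hH hb, hc]
  have h1 : ((α ^ i)⁻¹) ^ n = 1 := by
    rw [inv_pow, pow_pow_eq_one_of_isPrimitiveRoot hα, inv_one]
  have h2 := aeval_inv_mul_aeval h1 (x := x) (c := c) fun s => hx _ (cyc_mem_narrowBCH hα hcC s)
  rw [inv_inv, hc] at h2
  exact (mul_eq_zero.1 h2).resolve_right (aeval_inv_oddGenerator_ne_zero hα hn hodd hm hH hb hi hib)

/-- Dual containment gives 2^n = |C^⊥||C| ≤ |C|^2. -/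
lemma two_mul_le (hα : IsPrimitiveRoot α n) (hn : n ≠ 0) (hodd : Nat.Coprime n 2)
    (hm : m = orderOf (2 : ZMod n)) (hH : CosetBound n m b) (hb : b = 2 * t + 1) :
    2 * m * (t + 1) ≤ n := by
  have h1 := card_narrowBCH hα hn hodd hm hH hb
  have h2 := card_dualCode_mul_card (narrowBCH n α (b + 1))
  have hlt := natDegree_oddGenerator_lt hα hn hodd hm hH hb
  rw [natDegree_oddGenerator hα hn hodd hm hH hb] at hlt
  have h3 : Nat.card (dualCode (narrowBCH n α (b + 1))) ≤ Nat.card (narrowBCH n α (b + 1)) :=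
    Nat.card_le_card_of_injective _
      (Submodule.inclusion_injective (dualCode_narrowBCH_le hα hn hodd hm hH hb))
  have h4 : 2 ^ n ≤ 2 ^ (n - m * (t + 1) + (n - m * (t + 1))) := by
    rw [← h2, pow_add, ← h1]
    exact Nat.mul_le_mul_right _ h3
  have h5 := (Nat.pow_le_pow_iff_right (by norm_num)).1 h4
  rw [mul_assoc]
  omega

lemma lt_minDist_narrowBCH (hα : IsPrimitiveRoot α n) (hn : n ≠ 0) (hodd : Nat.Coprime n 2)
    (hm : m = orderOf (2 : ZMod n)) (hH : CosetBound n m b) (hb : b = 2 * t + 1) :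
    b + 1 ≤ minDist (narrowBCH n α (b + 1)) := by
  refine le_minDist ?_ fun c hc h0 => lt_hammingNorm_of_mem_narrowBCH hα hc h0
  -- A nonzero codeword is needed, since the infimum of the empty set is 0.
  obtain ⟨c, hc⟩ := exists_wordPoly_eq (natDegree_oddGenerator_lt hα hn hodd hm hH hb)
  refine ⟨c, ?_, ?_⟩
  · rw [mem_narrowBCH hα, ← oddGenerator_dvd_iff hα hn hodd hm hH hb, hc]
  · rintro rfl
    have : (0 : (ZMod 2)[X]) = oddGenerator α t := by rw [← hc]; simp [wordPoly]
    exact (monic_oddGenerator hα hn).ne_zero this.symm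

/-- Distinct cyclic shifts of the generator word of the larger code lie in distinct cosets of the
smaller code. -/
lemma eq_of_cyc_add_cyc_mem [NeZero n] {e w : ℕ} (hα : IsPrimitiveRoot α n)
    (hodd : Nat.Coprime n 2)
    (hm : m = orderOf (2 : ZMod n)) (hH : CosetBound n m b) (hHe : CosetBound n m e)
    (hb : b = 2 * t + 1) (he : e = 2 * w + 1)
    {g : Fin n → ZMod 2} (hg : wordPoly g = oddGenerator α w) {s s' : ℕ} (hs : s < m * (t - w))
    (hs' : s' < m * (t - w)) (h : cyc g s + cyc g s' ∈ narrowBCH n α (b + 1)) : s = s' := by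
  have hn := NeZero.ne n
  have hα0 := hα.ne_zero hn
  -- At a root γ, the shifts of g take the values γ^(-s) g(γ) and γ^(-s') g(γ); multiplying their
  -- sum by γ^(s+s') clears the inverses. If s ≠ s', comparing degrees gives m(t+1) ≤ max(s, s') +
  -- m(w+1), which is too small.
  have key : oddGenerator α t ∣ (X ^ s' + X ^ s) * oddGenerator α w := by
    rw [oddGenerator_dvd_iff hα hn hodd hm hH hb]
    intro i hi hib
    have h1 := (mem_narrowBCH hα).1 h i hi hib
    have hi1 := pow_pow_eq_one_of_isPrimitiveRoot hα i
    rw [wordPoly_add, map_add] at h1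
    have h2 := pow_mul_aeval_cyc hi1 g s
    have h3 := pow_mul_aeval_cyc hi1 g s'
    rw [hg] at h2 h3
    simp only [map_mul, map_add, map_pow, aeval_X]
    linear_combination (-(α ^ i) ^ s') * h2 - (α ^ i) ^ s * h3 +
      (α ^ i) ^ s * (α ^ i) ^ s' * h1
  by_contra hne
  have hpoly : (X ^ s' + X ^ s : (ZMod 2)[X]) ≠ 0 := by
    intro h0
    have := congrArg (fun p => p.coeff s) h0
    simp [coeff_X_pow, hne] at this
  have hmonw : (oddGenerator α w).Monic := monic_oddGenerator hα hn
  have hd := natDegree_le_of_dvd key (mul_ne_zero hpoly hmonw.ne_zero)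
  rw [natDegree_mul hpoly hmonw.ne_zero, natDegree_oddGenerator hα hn hodd hm hH hb,
    natDegree_oddGenerator hα hn hodd hm hHe he] at hd
  have hd2 : (X ^ s' + X ^ s : (ZMod 2)[X]).natDegree < m * (t - w) := by
    refine (natDegree_add_le _ _).trans_lt ?_
    simp [hs, hs']
  have hwt : w ≤ t := by
    by_contra hlt
    rw [Nat.sub_eq_zero_of_le (by omega)] at hs
    omega
  have hmt : m * (t + 1) = m * (t - w) + m * (w + 1) := by
    rw [← mul_add]; congr 1; omega
  omega

end BCH

/-! ### Cyclic extension of words -/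

section Extension

variable {n N : ℕ} [NeZero n]

/-- The position modulo `n`. -/
def residue (n N : ℕ) [NeZero n] (i : Fin N) : Fin n := ⟨i % n, Nat.mod_lt _ (NeZero.pos n)⟩

/-- The extension of a word of length `n` to length `N` by periodicity. -/
def periodize (n N : ℕ) [NeZero n] : (Fin n → ZMod 2) →ₗ[ZMod 2] (Fin N → ZMod 2) :=
  LinearMap.funLeft (ZMod 2) (ZMod 2) (residue n N)

lemma periodize_apply (c : Fin n → ZMod 2) (i : Fin N) :
    periodize n N c i = c (residue n N i) := rfl

/-- The adjoint of `periodize`. -/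
def fold (n : ℕ) [NeZero n] (v : Fin N → ZMod 2) : Fin n → ZMod 2 :=
  fun j => ∑ i, if residue n N i = j then v i else 0

lemma fold_dotProduct (v : Fin N → ZMod 2) (c : Fin n → ZMod 2) :
    fold n v ⬝ᵥ c = v ⬝ᵥ periodize n N c := by
  simp only [dotProduct, fold, Finset.sum_mul, periodize_apply]
  rw [Finset.sum_comm]
  refine Finset.sum_congr rfl fun i _ => ?_
  simp

/-- Each nonzero folded entry needs a nonzero entry above it. -/
lemma hammingNorm_fold_le (v : Fin N → ZMod 2) : hammingNorm (fold n v) ≤ hammingNorm v := by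
  classical
  unfold hammingNorm
  refine (Finset.card_le_card ?_).trans (Finset.card_image_le (f := residue n N))
  intro j hj
  rw [Finset.mem_filter] at hj
  obtain ⟨i, -, hi⟩ := Finset.exists_ne_zero_of_sum_ne_zero hj.2
  rw [Finset.mem_image]
  refine ⟨i, ?_, ?_⟩
  · rw [Finset.mem_filter]
    exact ⟨Finset.mem_univ _, fun h => hi (by simp [h])⟩
  · by_contra h
    exact hi (by simp [h])

lemma hammingNorm_comp_le_of_injective {k l : ℕ} {f : Fin k → Fin l} (hf : Function.Injective f)
    (v : Fin l → ZMod 2) : hammingNorm (v ∘ f) ≤ hammingNorm v :=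
  Finset.card_le_card_of_injOn f (fun i hi => by simpa using hi) hf.injOn

lemma periodize_comp_castLE (h : n ≤ N) (c : Fin n → ZMod 2) :
    periodize n N c ∘ Fin.castLE h = c := by
  ext i
  simp only [Function.comp, periodize_apply]
  congr 1
  ext
  exact Nat.mod_eq_of_lt i.2

lemma periodize_injective (h : n ≤ N) : Function.Injective (periodize n N) := by
  intro c c' hc
  rw [← periodize_comp_castLE h c, hc, periodize_comp_castLE h c']

lemma hammingNorm_le_periodize (h : n ≤ N) (c : Fin n → ZMod 2) :
    hammingNorm c ≤ hammingNorm (periodize n N c) := by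
  conv_lhs => rw [← periodize_comp_castLE h c]
  exact hammingNorm_comp_le_of_injective (Fin.castLE_injective h) _

lemma hammingNorm_add_le {k : ℕ} (x y : Fin k → ZMod 2) :
    hammingNorm (x + y) ≤ hammingNorm x + hammingNorm y := by
  have h := hammingDist_triangle x 0 y
  rwa [hammingDist_zero_right, hammingDist_zero_left, hammingDist_eq_hammingNorm,
    ZModModule.neg_eq_self] at h

lemma cyc_add (c c' : Fin n → ZMod 2) (s : ℕ) : cyc (c + c') s = cyc c s + cyc c' s := rfl

/-- The quantum synchronizable code of a dual-containing cyclic code `C`, a supercode `D` and a word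
`g ∈ D` whose cyclic shifts are in distinct cosets of `C`. -/
theorem exists_isQSC_of_cyclic {al ar k tp tb : ℕ} {C D : Submodule (ZMod 2) (Fin n → ZMod 2)}
    (hdual : dualCode C ≤ C) (hCD : C ≤ D) (hCcyc : ∀ c ∈ C, ∀ s, cyc c s ∈ C)
    (hDcyc : ∀ c ∈ D, ∀ s, cyc c s ∈ D) {g : Fin n → ZMod 2} (hg : g ∈ D)
    (htp : ∀ c ∈ C, hammingNorm c ≤ 2 * tp → c = 0) (htb : ∀ c ∈ D, hammingNorm c ≤ 2 * tb → c = 0)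
    (hk : Nat.card C = 2 ^ k * Nat.card (dualCode C))
    (hsync : ∀ s s', s ≤ al + ar → s' ≤ al + ar → cyc g s + cyc g s' ∈ C → s = s') :
    ∃ Q : Submodule ℂ (Qubits (Fin (n + al + ar))), IsQSC al ar (n + al + ar) k tp tb Q := by
  classical
  set N := n + al + ar with hN
  have hnN : n ≤ N := by omega
  have hinj := periodize_injective hnN
  have hcard : ∀ H : Submodule (ZMod 2) (Fin n → ZMod 2),
      Nat.card (H.map (periodize n N)) = Nat.card H := fun H =>
    (Nat.card_congr (H.equivMapOfInjective _ hinj).toEquiv).symm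
  -- Position al + i of a window at offset s is position s + i of the frame, and s + i < N because s
  -- ≤ al + ar. So this block never leaves the frame.
  set inner : Fin n → Fin N := fun i => ⟨al + i, by omega⟩ with hinner
  let P : Fin (al + ar + 1) → (Fin N → ZMod 2) → Prop := fun s z =>
    ∃ c ∈ C, ∃ e : Fin n → ZMod 2, hammingNorm e ≤ tb ∧ z ∘ inner = cyc (c + g) s + e
  have huniq : ∀ s s' z, P s z → P s' z → s = s' := by
    rintro s s' z ⟨c, hc, e, he, h⟩ ⟨c', hc', e', he', h'⟩
    have h1 : cyc (c + g) s + cyc (c' + g) s' = e + e' := by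
      rw [h] at h'
      calc cyc (c + g) s + cyc (c' + g) s'
          = (cyc (c + g) s + e) + e + cyc (c' + g) s' := by
            rw [add_assoc (cyc (c + g) s), ZModModule.add_self, add_zero]
        _ = e + e' + (cyc (c' + g) s' + cyc (c' + g) s') := by rw [h']; abel
        _ = e + e' := by rw [ZModModule.add_self, add_zero]
    -- The two error patterns differ by a word of D of weight at most 2*tb, so they coincide; what
    -- remains places a sum of two shifts of g in C.
    have h2 : e + e' = 0 := by
      refine htb _ ?_ ((hammingNorm_add_le e e').trans (by omega))
      rw [← h1]
      exact add_mem (hDcyc _ (add_mem (hCD hc) hg) s) (hDcyc _ (add_mem (hCD hc') hg) s')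
    rw [h2, cyc_add, cyc_add, show cyc c s + cyc g s + (cyc c' s' + cyc g s') =
      cyc g s + cyc g s' + (cyc c s + cyc c' s') by abel] at h1
    have h3 : cyc g s + cyc g s' ∈ C := by
      have h4 := add_mem (hCcyc c hc s) (hCcyc c' hc' s')
      rw [← Submodule.add_mem_iff_left C h4, h1]
      exact zero_mem C
    exact Fin.ext (hsync s s' (by omega) (by omega) h3)
  refine ⟨_, isQSC_cssCode (A := C.map (periodize n N)) (B := (dualCode C).map (periodize n N))
    (Submodule.map_mono hdual) (g := periodize n N g) ?_ ?_ ?_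
    -- The default 0 is arbitrary: admissible windows always satisfy some `P s`.
    (fun z => if h : ∃ s, P s z then h.choose else 0) ?_⟩
  · intro u u' hu hu' ⟨c, hc, hcu⟩
    have h0 : c = 0 := by
      refine htb c (hCD hc) ((hammingNorm_le_periodize hnN c).trans ?_)
      rw [hcu]
      exact (hammingNorm_add_le u u').trans (by omega)
    rw [h0, map_zero] at hcu
    rw [← add_zero u, hcu, ← add_assoc, ZModModule.add_self, zero_add]
  · intro v v' hv hv' hvv x hx
    -- The folded word is orthogonal to the dual of C, so it lies in C and has weight at most 2*tp.
    -- Thus v + v' annihilates every periodic word, though v and v' may differ.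
    have h0 : fold n (v + v') = 0 := by
      refine htp _ ?_ ((hammingNorm_fold_le _).trans ((hammingNorm_add_le v v').trans (by omega)))
      rw [← dualCode_dualCode C]
      intro y hy
      rw [fold_dotProduct]
      exact hvv _ (Submodule.mem_map_of_mem hy)
    obtain ⟨c, -, hc⟩ := hx
    have hxc : x = periodize n N (c + g) := by
      rw [map_add, hc, add_assoc, ZModModule.add_self, add_zero]
    rw [hxc, ← fold_dotProduct, h0, zero_dotProduct]
  · rw [hcard, hcard, hk]
  · rintro s u hu x ⟨c, hc, hcx⟩
    have hP : P s (x ∘ window al ar N s) := by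
      refine ⟨c, hc, u ∘ fun i : Fin n => ⟨s + i, by omega⟩, ?_, ?_⟩
      · refine (hammingNorm_comp_le_of_injective ?_ u).trans hu
        intro i j h
        simpa [Fin.ext_iff] using h
      · ext i
        have hx : x ∘ frame al ar N = periodize n N (c + g) + u := by
          rw [map_add, hcx]
          have : ∀ y z w : Fin N → ZMod 2, y = y + z + w + w + z := fun y z w => by
            rw [add_assoc (y + z) w w, ZModModule.add_self, add_zero, add_assoc,
              ZModModule.add_self, add_zero]
          exact this _ _ _
        have h1 := congrFun hx ⟨s + i, by omega⟩
        rw [Pi.add_apply, periodize_apply] at h1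
        rw [Pi.add_apply, cyc_apply]
        refine Eq.trans ?_ h1
        simp only [Function.comp, window, frame, hinner]
        congr 2
        omega
    have hex : ∃ s', P s' (x ∘ window al ar N s) := ⟨s, hP⟩
    rw [dif_pos hex]
    exact huniq _ _ _ hex.choose_spec hP

end Extension

end QSync

/-! ### The theorem for the given parameters. -/

theorem theorem6 (n m : ℕ) (hn : 3 ≤ n) (hodd : Nat.Coprime n 2)
    (hm : m = orderOf (2 : ZMod n)) (hlow : 2 ^ (m / 2) < n) (hupp : n ≤ 2 ^ m - 1)
    (a b e f t w : ℕ) (he2 : 2 ≤ e) (hea : e < a) (hab : a < b) (hbf : b < f)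
    (hf : (f : ℤ) < min (min ⌊(n : ℚ) * 2 ^ ((m + 1) / 2) / (2 ^ m - 1) - 1⌋ ((n : ℤ) - 1))
      ⌊(n : ℚ) / (2 ^ m - 1) * (2 ^ ((m + 1) / 2) - 1)⌋)
    (ha_odd : Odd a) (hb_odd : Odd b) (he_odd : Odd e) (hf_odd : Odd f)
    (ht : t = (b - 1) / 2) (hw : w = (e - 1) / 2)
    {K : Type*} [Field K] [Algebra (ZMod 2) K] (α : K) (hα : IsPrimitiveRoot α n)
    (C₁ C₂ C₃ C₄ : Submodule (ZMod 2) (Fin n → ZMod 2))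
    (hC₁ : C₁ = QSync.narrowBCH n α (b + 1)) (hC₂ : C₂ = QSync.narrowBCH n α (a + 1))
    (hC₃ : C₃ = QSync.narrowBCH n α (f + 1)) (hC₄ : C₄ = QSync.narrowBCH n α (e + 1)) :
    b + 1 ≤ QSync.minDist (C₁ ⊔ C₃) ∧ e + 1 ≤ QSync.minDist (C₂ ⊔ C₄) ∧
    2 * m * (t + 1) ≤ n ∧
    ∀ al ar : ℕ, al + ar < m * (t - w) →
      ∃ Q : Submodule ℂ (QSync.Qubits (Fin (n + al + ar))),
        QSync.IsQSC al ar (n + al + ar) (n - 2 * m * (t + 1))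
          ((QSync.minDist (C₁ ⊔ C₃) - 1) / 2) ((QSync.minDist (C₂ ⊔ C₄) - 1) / 2) Q := by
  have hn0 : n ≠ 0 := by omega
  have : NeZero n := ⟨hn0⟩
  have hm0 : 0 < m := by
    rcases Nat.eq_zero_or_pos m with rfl | h
    · simp at hupp; omega
    · exact h
  have hdvd : n ∣ 2 ^ m - 1 := by
    refine (Nat.modEq_iff_dvd' Nat.one_le_two_pow).1 ?_
    rw [← ZMod.natCast_eq_natCast_iff]
    push_cast
    rw [hm, pow_orderOf_eq_one]
  obtain ⟨r, hr⟩ := hdvd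
  have hr0 : 0 < r := by
    rcases Nat.eq_zero_or_pos r with rfl | h
    · simp only [mul_zero] at hr; omega
    · exact h
  -- The bound f + 1 ≤ κ multiplied by r, with κ*r = 2^⌈m/2⌉ - 1.
  have hfr : (f + 1) * r + 1 ≤ 2 ^ ((m + 1) / 2) := by
    have h1 : ((f + 1 : ℤ)) ≤ ⌊(n : ℚ) / (2 ^ m - 1) * (2 ^ ((m + 1) / 2) - 1)⌋ :=
      Int.add_one_le_iff.2 (lt_min_iff.1 hf).2
    rw [Int.le_floor] at h1
    have hrq : (n : ℚ) * r = 2 ^ m - 1 := by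
      have : ((2 ^ m - 1 : ℕ) : ℚ) = 2 ^ m - 1 := by
        rw [Nat.cast_sub Nat.one_le_two_pow]; push_cast; ring
      rw [← this, hr]; push_cast; ring
    have hr0' : (0 : ℚ) < r := by exact_mod_cast hr0
    have hn0' : (0 : ℚ) < n := by exact_mod_cast Nat.pos_of_ne_zero hn0
    have h2 : (n : ℚ) / (2 ^ m - 1) * r = 1 := by
      rw [← hrq]; field_simp
    have h3 := mul_le_mul_of_nonneg_right h1 hr0'.le
    rw [mul_right_comm, h2, one_mul] at h3
    have h4 : ((f + 1) * r + 1 : ℚ) ≤ 2 ^ ((m + 1) / 2) := by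
      push_cast at h3; linarith
    exact_mod_cast h4
  have hbound : ∀ {i}, i < f → QSync.CosetBound n m i := fun {i} hi => by
    refine QSync.cosetBound hm0 hr.symm ?_
    have : i * r + r ≤ f * r := by
      rw [← Nat.succ_mul]; exact Nat.mul_le_mul_right r hi
    rw [Nat.succ_mul] at hfr
    omega
  have hHb := hbound hbf
  have hHe : QSync.CosetBound n m e := hbound (by omega)
  have hbt : b = 2 * t + 1 := by obtain ⟨j, rfl⟩ := hb_odd; omega
  have hew : e = 2 * w + 1 := by obtain ⟨j, rfl⟩ := he_odd; omega
  have h13 : C₁ ⊔ C₃ = QSync.narrowBCH n α (b + 1) := by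
    rw [hC₁, hC₃]; exact sup_eq_left.2 (QSync.narrowBCH_anti hα hbf.le)
  have h24 : C₂ ⊔ C₄ = QSync.narrowBCH n α (e + 1) := by
    rw [hC₂, hC₄]; exact sup_eq_right.2 (QSync.narrowBCH_anti hα hea.le)
  rw [h13, h24]
  have hd := QSync.lt_minDist_narrowBCH hα hn0 hodd hm hHb hbt
  have hd' := QSync.lt_minDist_narrowBCH hα hn0 hodd hm hHe hew
  have hle := QSync.two_mul_le hα hn0 hodd hm hHb hbt
  refine ⟨hd, hd', hle, fun al ar hs => ?_⟩
  obtain ⟨g, hg⟩ :=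
    QSync.exists_wordPoly_eq (QSync.natDegree_oddGenerator_lt hα hn0 hodd hm hHe hew)
  refine QSync.exists_isQSC_of_cyclic (C := QSync.narrowBCH n α (b + 1))
    (D := QSync.narrowBCH n α (e + 1)) (g := g)
    (QSync.dualCode_narrowBCH_le hα hn0 hodd hm hHb hbt) (QSync.narrowBCH_anti hα (by omega))
    (fun c hc s => QSync.cyc_mem_narrowBCH hα hc s) (fun c hc s => QSync.cyc_mem_narrowBCH hα hc s)
    -- Twice ⌊(d-1)/2⌋ is below d because `hd` makes d positive; likewise for d*.
    ?_ (fun c hc h => QSync.eq_zero_of_hammingNorm_lt hc (by omega))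
    (fun c hc h => QSync.eq_zero_of_hammingNorm_lt hc (by omega)) ?_ ?_
  · rw [QSync.mem_narrowBCH hα, ← QSync.oddGenerator_dvd_iff hα hn0 hodd hm hHe hew, hg]
  · have h1 := QSync.card_narrowBCH hα hn0 hodd hm hHb hbt
    have h2 := QSync.card_dualCode_mul_card (QSync.narrowBCH n α (b + 1))
    have h3 : Nat.card (QSync.dualCode (QSync.narrowBCH n α (b + 1))) = 2 ^ (m * (t + 1)) := by
      rw [h1] at h2
      refine Nat.eq_of_mul_eq_mul_right (Nat.two_pow_pos (n - m * (t + 1))) ?_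
      rw [h2, ← pow_add]
      congr 1
      rw [mul_assoc] at hle
      omega
    rw [h1, h3, ← pow_add]
    congr 1
    rw [mul_assoc] at hle ⊢
    omega
  · intro s s' hs1 hs2 h
    exact QSync.eq_of_cyc_add_cyc_mem hα hodd hm hHb hHe hbt hew hg (by omega) (by omega) h
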